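/- **Setting.** Let $(V,Y,\mathbf 1,\omega)$ be a vertex operator algebra over $\mathbb C$, with $Y(v,z)=\sum_{n\in\mathbb Z}v_nz^{-n-1}$, $L(n)=\omega_{n+1}$, and $V=\bigoplus_{n\in\mathbb Z}V_n$, where $V_n=\{v : L(0)v=nv\}$ is the space of homogeneous vectors of weight $n$ ($\operatorname{wt}v=n$). Let $g$ be an automorphism of $V$ of finite order $T$, and for $0\le r\le T-1$ let $V^r=\{v\in V : gv=e^{2\pi i r/T}v\}$. For homogeneous $u\in V^r$ and $v\in V$ put, with $\delta_r=1$ if $r=0$ and $\delta_r=0$ otherwise, $$u\circ_g v=\operatorname{Res}_z\frac{(1+z)^{\operatorname{wt}u-1+\delta_r+r/T}}{z^{1+\delta_r}}Y(u,z)v,\qquad u*_gv=\begin{cases}\operatorname{Res}_z\frac{(1+z)^{\operatorname{wt}u}}{z}Y(u,z)v & r=0,\\ 0 & r>0,\end{cases}$$ extend $*_g$ bilinearly to $V$, let $O_g(V)$ be the linear span of all $u\circ_gv$, and let $A_g(V)=V/O_g(V)$. The product $*_g$ makes $A_g(V)$ an associative algebra whose identity is the class of $\mathbf 1$. A weak $g$-twisted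 $V$-module is a complex vector space $M$ with a linear map $v\mapsto Y_M(v,z)=\sum_{n\in\mathbb Q}v_nz^{-n-1}$, $v_n\in\operatorname{End}M$, such that for all $0\le r\le T-1$, $u\in V^r$, $v\in V$, $w\in M$: $u_n=0$ unless $n\in\frac rT+\mathbb Z$; $v_nw=0$ for $n$ sufficiently large; $Y_M(\mathbf 1,z)=1$; and the twisted Jacobi identity holds: $$z_0^{-1}\delta\Big(\frac{z_1-z_2}{z_0}\Big)Y_M(u,z_1)Y_M(v,z_2)-z_0^{-1}\delta\Big(\frac{z_2-z_1}{-z_0}\Big)Y_M(v,z_2)Y_M(u,z_1)=z_2^{-1}\Big(\frac{z_1-z_0}{z_2}\Big)^{-r/T}\delta\Big(\frac{z_1-z_0}{z_2}\Big)Y_M(Y(u,z_0)v,z_2).$$ It is admissible if it carries a grading $M=\bigoplus_{n\in\frac1T\mathbb Z_{\ge0}}M(n)$ such that $v_mM(n)\subseteq M(n+\operatorname{wt}v-m-1)$ for all homogeneous $v\in V$, and all $m,n$ (with $M(q)=0$ for $q\notin\frac1T\mathbb Z_{\ge 0}$). An admissible module $M$ is simple if $M\neq0$ and its only graded submodules are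 $0$ and $M$. Let $$\Omega(M)=\{w\in M : a_mw=0\text{ for all homogeneous }a\in V\text{ and all }m\in\mathbb Q\text{ with }\operatorname{wt}a-m-1<0\}.$$ **Proposition.** Let $M$ be a simple admissible $g$-twisted $V$-module, with the grading shifted so that $M(0)\ne0$. Then (i) $\Omega(M)=M(0)$; (ii) $\Omega(M)$ is a simple $A_g(V)$-module, where the class in $A_g(V)$ of a homogeneous vector $a\in V^0$ acts as $o(a)=a_{\operatorname{wt}a-1}$. -/

import Mathlib

open scoped DirectSum

noncomputable section

/-- A vertex operator algebra `(V, Y, 𝟏, ω)` over `ℂ`, with `Y(u, z) = ∑ₙ uₙ z⁻ⁿ⁻¹`; here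
`Y u n` is the mode `uₙ`. The operators `L(n) = ωₙ₊₁` are the modes of the conformal vector, and
the homogeneous space `V_n` is the eigenspace of `L(0)` for the eigenvalue `n`. -/
structure VertexOperatorAlgebra (V : Type*) [AddCommGroup V] [Module ℂ V] where
  /-- the modes `uₙ` of the vertex operators `Y(u, z)` -/
  Y : V →ₗ[ℂ] (ℤ → Module.End ℂ V)
  /-- the vacuum vector `𝟏` -/
  vac : V
  /-- the conformal (Virasoro) vector `ω` -/
  omega : V
  /-- the rank (central charge) -/
  rank : ℂ
  /-- `uₙ v = 0` for `n` sufficiently large -/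
  truncation : ∀ u v : V, ∃ N : ℤ, ∀ n : ℤ, N ≤ n → Y u n v = 0
  /-- `Y(𝟏, z) = 1` -/
  vacuum : ∀ n : ℤ, Y vac n = if n = -1 then 1 else 0
  /-- `Y(u, z)𝟏` is a power series in `z` -/
  creation_regular : ∀ (u : V) (n : ℤ), 0 ≤ n → Y u n vac = 0
  /-- the constant term of `Y(u, z)𝟏` is `u` -/
  creation : ∀ u : V, Y u (-1) vac = u
  /-- The Jacobi identity: the coefficient of `z₀⁻ˡ⁻¹ z₁⁻ᵐ⁻¹ z₂⁻ⁿ⁻¹`, applied to `w`. All sums are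
  finite by truncation. -/
  jacobi : ∀ (u v w : V) (l m n : ℤ),
    (∑ᶠ i : ℕ, ((-1 : ℂ) ^ i * ((Ring.choose l i : ℤ) : ℂ)) •
        (Y u (l + m - i) (Y v (n + i) w) - (-1 : ℂ) ^ l • Y v (l + n - i) (Y u (m + i) w))) =
      ∑ᶠ i : ℕ, ((Ring.choose m i : ℤ) : ℂ) • Y (Y u (l + i) v) (m + n - i) w
  /-- the Virasoro relations for `L(n) = ωₙ₊₁` -/
  virasoro : ∀ m n : ℤ,
    Y omega (m + 1) * Y omega (n + 1) - Y omega (n + 1) * Y omega (m + 1) =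
      ((m : ℂ) - n) • Y omega (m + n + 1) +
        (if m + n = 0 then (1 / 12 : ℂ) * ((m : ℂ) ^ 3 - m) * rank else 0) •
          (1 : Module.End ℂ V)
  /-- `d/dz Y(v, z) = Y(L(-1)v, z)` -/
  derivative : ∀ (v : V) (n : ℤ), Y (Y omega 0 v) n = (-(n : ℂ)) • Y v (n - 1)
  /-- `V` is the direct sum of the eigenspaces `V_n` of `L(0)`, `n ∈ ℤ` -/
  grading : DirectSum.IsInternal fun n : ℤ => Module.End.eigenspace (Y omega 1) (n : ℂ)
  /-- the homogeneous spaces are finite-dimensional -/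
  finite_dim : ∀ n : ℤ, FiniteDimensional ℂ (Module.End.eigenspace (Y omega 1) (n : ℂ))
  /-- `V_n = 0` for `n` sufficiently small -/
  bounded_below : ∃ N : ℤ, ∀ n : ℤ, n < N → Module.End.eigenspace (Y omega 1) (n : ℂ) = ⊥

namespace VertexOperatorAlgebra

variable {V : Type*} [AddCommGroup V] [Module ℂ V]

/-- The space `V_n` of homogeneous vectors of weight `n`. -/
def weightSpace (A : VertexOperatorAlgebra V) (n : ℤ) : Submodule ℂ V :=
  Module.End.eigenspace (A.Y A.omega 1) (n : ℂ)

/-- `g` is an automorphism of the vertex operator algebra. -/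
structure IsAutomorphism (A : VertexOperatorAlgebra V) (g : V ≃ₗ[ℂ] V) : Prop where
  map_vac : g A.vac = A.vac
  map_omega : g A.omega = A.omega
  map_mode : ∀ (u v : V) (n : ℤ), g (A.Y u n v) = A.Y (g u) n (g v)

end VertexOperatorAlgebra

/-- The eigenspace `V^r = {v | g v = exp (2 π i r / T) v}`. -/
def twistEigenspace {V : Type*} [AddCommGroup V] [Module ℂ V] (T : ℕ) (g : V ≃ₗ[ℂ] V) (r : ℕ) :
    Submodule ℂ V :=
  Module.End.eigenspace (g : V →ₗ[ℂ] V)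
    (Complex.exp (2 * Real.pi * Complex.I * (r : ℂ) / (T : ℂ)))

section ZhuAlgebra

variable {V : Type*} [AddCommGroup V] [Module ℂ V]

/-- For `u ∈ V^r` homogeneous of weight `k`, and `δ = 1` if `r = 0`, `δ = 0` otherwise,
`u ∘_g v = Res_z (1 + z) ^ (k - 1 + δ + r / T) z ^ (-1 - δ) Y(u, z) v`. -/
def circProd (A : VertexOperatorAlgebra V) (T r : ℕ) (k : ℤ) (u v : V) : V :=
  let δ : ℤ := if r = 0 then 1 else 0
  ∑ᶠ i : ℕ, ((Ring.choose ((k : ℚ) - 1 + (δ : ℚ) + (r : ℚ) / (T : ℚ)) i : ℚ) : ℂ) •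
    A.Y u ((i : ℤ) - 1 - δ) v

/-- For `u ∈ V^r` homogeneous of weight `k`,
`u *_g v = Res_z (1 + z) ^ k z⁻¹ Y(u, z) v` if `r = 0`, and `u *_g v = 0` otherwise. -/
def starProd (A : VertexOperatorAlgebra V) (r : ℕ) (k : ℤ) (u v : V) : V :=
  if r = 0 then ∑ᶠ i : ℕ, ((Ring.choose k i : ℤ) : ℂ) • A.Y u ((i : ℤ) - 1) v else 0

/-- `O_g(V)`: the linear span of all `u ∘_g v` with `u ∈ V^r` homogeneous and `v ∈ V`. -/
def OgSubmodule (A : VertexOperatorAlgebra V) (T : ℕ) (g : V ≃ₗ[ℂ] V) : Submodule ℂ V :=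
  Submodule.span ℂ {x | ∃ (r : ℕ) (k : ℤ) (u v : V), r < T ∧ u ∈ twistEigenspace T g r ∧
    u ∈ A.weightSpace k ∧ x = circProd A T r k u v}

/-- The space `A_g(V) = V / O_g(V)`. -/
abbrev AgSpace (A : VertexOperatorAlgebra V) (T : ℕ) (g : V ≃ₗ[ℂ] V) : Type _ :=
  V ⧸ OgSubmodule A T g

/-- The associative unital algebra structure on `A_g(V) = V / O_g(V)` induced by the product
`*_g`. As `*_g` is the bilinear extension of its values on homogeneous eigenvectors of `g` in
the first argument, and these span `V`, there is at most one such structure. -/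
structure AgAlgebra (A : VertexOperatorAlgebra V) (T : ℕ) (g : V ≃ₗ[ℂ] V) where
  /-- the product of `A_g(V)` -/
  mul : AgSpace A T g →ₗ[ℂ] AgSpace A T g →ₗ[ℂ] AgSpace A T g
  /-- the product is induced by `*_g` -/
  mul_mk : ∀ (r : ℕ) (k : ℤ) (u v : V), r < T → u ∈ twistEigenspace T g r →
    u ∈ A.weightSpace k →
      mul (Submodule.Quotient.mk u) (Submodule.Quotient.mk v) =
        Submodule.Quotient.mk (starProd A r k u v)
  mul_assoc : ∀ a b c, mul (mul a b) c = mul a (mul b c)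
  /-- the class of the vacuum is a left identity -/
  vac_mul : ∀ a, mul (Submodule.Quotient.mk A.vac) a = a
  /-- the class of the vacuum is a right identity -/
  mul_vac : ∀ a, mul a (Submodule.Quotient.mk A.vac) = a

namespace AgAlgebra

variable {A : VertexOperatorAlgebra V} {T : ℕ} {g : V ≃ₗ[ℂ] V}

/-- The space `A_g(V)`, regarded as an algebra. -/
def Carrier (_S : AgAlgebra A T g) : Type _ := AgSpace A T g

/-- The class in `A_g(V)` of a vector of `V`. -/
def toClass (S : AgAlgebra A T g) (v : V) : S.Carrier := (Submodule.Quotient.mk v : AgSpace A T g)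

instance (S : AgAlgebra A T g) : AddCommGroup S.Carrier :=
  inferInstanceAs (AddCommGroup (AgSpace A T g))

instance (S : AgAlgebra A T g) : Module ℂ S.Carrier :=
  inferInstanceAs (Module ℂ (AgSpace A T g))

instance (S : AgAlgebra A T g) : Ring S.Carrier :=
  { (inferInstance : AddCommGroup S.Carrier) with
    mul := fun a b => S.mul a b
    one := S.toClass A.vac
    mul_assoc := S.mul_assoc
    one_mul := S.vac_mul
    mul_one := S.mul_vac
    left_distrib := fun a b c => (S.mul a).map_add b c
    right_distrib := fun a b c => S.mul.map_add₂ a b c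
    zero_mul := fun a => S.mul.map_zero₂ a
    mul_zero := fun a => (S.mul a).map_zero }

instance (S : AgAlgebra A T g) : Algebra ℂ S.Carrier :=
  Algebra.ofModule (fun c a b => S.mul.map_smul₂ c a b) (fun c a b => (S.mul a).map_smul c b)

end AgAlgebra

end ZhuAlgebra

/-- A weak `g`-twisted `V`-module structure on `M`: `Y_M(v, z) = ∑ vₙ z⁻ⁿ⁻¹` with `n ∈ ℚ`; here
`Y v n` is the mode `vₙ`. -/
structure WeakTwistedModule {V : Type*} [AddCommGroup V] [Module ℂ V]
    (A : VertexOperatorAlgebra V) (T : ℕ) (g : V ≃ₗ[ℂ] V)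
    (M : Type*) [AddCommGroup M] [Module ℂ M] where
  /-- the modes of the vertex operators on `M` -/
  Y : V →ₗ[ℂ] (ℚ → Module.End ℂ M)
  /-- for `u ∈ V^r`, only the modes `uₙ` with `n ∈ r / T + ℤ` occur -/
  mode_support : ∀ r : ℕ, r < T → ∀ u ∈ twistEigenspace T g r, ∀ n : ℚ,
    (¬ ∃ j : ℤ, n = (r : ℚ) / (T : ℚ) + j) → Y u n = 0
  /-- `vₙ w = 0` for `n` sufficiently large -/
  truncation : ∀ (v : V) (w : M), ∃ N : ℚ, ∀ n : ℚ, N ≤ n → Y v n w = 0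
  /-- `Y_M(𝟏, z) = 1` -/
  vacuum : ∀ n : ℚ, Y A.vac n = if n = -1 then 1 else 0
  /-- The twisted Jacobi identity for `u ∈ V^r`: the coefficient of `z₀⁻ˡ⁻¹ z₁⁻ᵐ⁻¹ z₂⁻ⁿ⁻¹`,
  applied to `w`. Both sides have no other powers of `z₁` than those with `m ∈ r / T + ℤ`. All
  sums are finite by truncation. -/
  jacobi : ∀ r : ℕ, r < T → ∀ u ∈ twistEigenspace T g r, ∀ (v : V) (w : M) (l : ℤ) (m n : ℚ),
    (∃ j : ℤ, m = (r : ℚ) / (T : ℚ) + j) →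
    (∑ᶠ i : ℕ, ((-1 : ℂ) ^ i * ((Ring.choose l i : ℤ) : ℂ)) •
        (Y u (l + m - i) (Y v (n + i) w) - (-1 : ℂ) ^ l • Y v (l + n - i) (Y u (m + i) w))) =
      ∑ᶠ i : ℕ, ((Ring.choose m i : ℚ) : ℂ) • Y (A.Y u (l + i) v) (m + n - i) w

/-- An admissible `g`-twisted `V`-module structure on `M`: a weak one with a grading
`M = ⨁ M(n)`, `n ∈ (1/T)ℤ₊`, such that `v_m M(n) ⊆ M(n + wt v - m - 1)` for homogeneous `v`. The
spaces `M(q)` with `q ∈ ℚ` outside `(1/T)ℤ₊` are zero. -/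
structure AdmissibleTwistedModule {V : Type*} [AddCommGroup V] [Module ℂ V]
    (A : VertexOperatorAlgebra V) (T : ℕ) (g : V ≃ₗ[ℂ] V)
    (M : Type*) [AddCommGroup M] [Module ℂ M] extends WeakTwistedModule A T g M where
  /-- the homogeneous space `M(n)` -/
  gr : ℚ → Submodule ℂ M
  gr_support : ∀ q : ℚ, (¬ ∃ j : ℕ, q = (j : ℚ) / (T : ℚ)) → gr q = ⊥
  gr_internal : DirectSum.IsInternal gr
  mode_gr : ∀ (k : ℤ), ∀ v ∈ A.weightSpace k, ∀ (m n : ℚ), ∀ w ∈ gr n,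
    Y v m w ∈ gr (n + k - m - 1)

section Modules

variable {V : Type*} [AddCommGroup V] [Module ℂ V] {A : VertexOperatorAlgebra V} {T : ℕ}
  {g : V ≃ₗ[ℂ] V} {M : Type*} [AddCommGroup M] [Module ℂ M]

/-- The space `Ω(M)` of lowest weight vectors: the vectors that are annihilated by `V[g]₋`, i.e.
by all modes `a_m` of negative degree `wt a - m - 1`, where `a ∈ V` is homogeneous. -/
def WeakTwistedModule.Omega (W : WeakTwistedModule A T g M) : Submodule ℂ M where
  carrier := {w | ∀ (k : ℤ), ∀ a ∈ A.weightSpace k, ∀ m : ℚ, (k : ℚ) - m - 1 < 0 → W.Y a m w = 0}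
  add_mem' := fun {x y} hx hy k a ha m hm => by
    rw [map_add, hx k a ha m hm, hy k a ha m hm, add_zero]
  zero_mem' := fun _ _ _ _ _ => map_zero _
  smul_mem' := fun c x hx k a ha m hm => by
    rw [map_smul, hx k a ha m hm, smul_zero]

/-- `N` is a graded submodule of the admissible `g`-twisted module. -/
structure AdmissibleTwistedModule.IsGradedSubmodule (W : AdmissibleTwistedModule A T g M)
    (N : Submodule ℂ M) : Prop where
  mode_mem : ∀ (v : V) (m : ℚ), ∀ w ∈ N, W.Y v m w ∈ N
  graded : N = ⨆ q : ℚ, N ⊓ W.gr q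

/-- A simple admissible `g`-twisted module: it is nonzero, and its only graded submodules are
`0` and itself. -/
def AdmissibleTwistedModule.IsSimple (W : AdmissibleTwistedModule A T g M) : Prop :=
  Nontrivial M ∧ ∀ N : Submodule ℂ M, W.IsGradedSubmodule N → N = ⊥ ∨ N = ⊤

end Modules

end

/-!
Write `R(α, n; u) = Res_z (1 + z) ^ α z ^ n Y(u, z)`. Pairing the Jacobi identity with powers of
`1 + z₁` and `1 + z₂` yields a Jacobi identity for the operators `R(α, n; u)`. Its commutator case
shows that `V *_g O_g(V) ⊆ O_g(V)`; its iterate case shows that `O_g(V) *_g V ⊆ O_g(V)` and that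
`*_g` is associative modulo `O_g(V)`, since `L(-1)u` and integration by parts place in `O_g(V)` all
residues with a pole of higher order than the one in `u ∘_g v`.

On `Ω(M)` only the extreme terms of the twisted Jacobi identity survive, so `o(u ∘_g v) = 0` and
`o(u *_g v) = o(u) o(v)`. By associativity the span of all `v_t w` is stable under `V`, so for
homogeneous `w ≠ 0` it equals the simple module `M`. For `w ∈ Ω(M)` of degree `q > 0` this span
lies in degrees `≥ q`, which contradicts `M(0) ≠ 0`; for `w ∈ M(0)` its part of degree `0` consists
of the vectors `o(v) w`, so `M(0)` is generated over `A_g(V)` by any of its nonzero vectors.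
-/

noncomputable section

open Finset Filter

/-! ### Binomial sums -/

theorem sum_range_sum_range_smul_add {R X : Type*} [Semiring R] [AddCommMonoid X] [Module R X]
    (c : ℕ → ℕ → R) {y : ℕ → X} {N : ℕ} (hy : ∀ m, N ≤ m → y m = 0) :
    ∑ j ∈ range N, ∑ k ∈ range N, c j k • y (j + k) =
      ∑ m ∈ range N, (∑ p ∈ antidiagonal m, c p.1 p.2) • y m := by
  have hdiag : ∀ m ∈ range N, (∑ p ∈ antidiagonal m, c p.1 p.2) • y m =
      ∑ j ∈ range (m + 1), c j (m - j) • y (j + (m - j)) := fun m _ => by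
    rw [Nat.sum_antidiagonal_eq_sum_range_succ_mk, sum_smul]
    exact sum_congr rfl fun j hj => by rw [Nat.add_sub_cancel' (mem_range_succ_iff.1 hj)]
  rw [sum_congr rfl hdiag, sum_range_diag_flip N fun j k => c j k • y (j + k)]
  refine sum_congr rfl fun j _ =>
    (sum_subset (range_subset_range.2 (Nat.sub_le N j)) fun k _ hk => ?_).symm
  rw [hy _ (by rw [mem_range] at hk; omega), smul_zero]

section Binomial

variable {R : Type*} [CommRing R] [BinomialRing R]

theorem choose_mul_natCast_choose (α : R) (s t : ℕ) :
    Ring.choose α (s + t) * ((s + t).choose s : R) = Ring.choose α s * Ring.choose (α - s) t := by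
  have h := Ring.choose_smul_choose α (Nat.le_add_right s t)
  rwa [nsmul_eq_mul, Nat.add_sub_cancel_left, mul_comm] at h

theorem succ_mul_choose_succ (α : R) (i : ℕ) :
    ((i : R) + 1) * Ring.choose α (i + 1) = α * Ring.choose (α - 1) i := by
  have h := choose_mul_natCast_choose α 1 i
  rw [Nat.choose_one_right, Ring.choose_one_right, add_comm 1 i, mul_comm] at h
  exact_mod_cast h

-- Both sides are the coefficient of `zᵐ` in `(1 + z) ^ β * (d/dz) ^ s / s! (1 + z) ^ α`.
theorem sum_antidiagonal_choose_mul_choose (α β : R) (s m : ℕ) :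
    ∑ p ∈ antidiagonal (s + m), Ring.choose α p.1 * Ring.choose β p.2 * (p.1.choose s : R) =
      Ring.choose α s * Ring.choose (α + β - s) m := by
  rw [show α + β - s = (α - s) + β by ring, Ring.add_choose_eq m (Commute.all _ _), mul_sum,
    Nat.sum_antidiagonal_eq_sum_range_succ_mk, Nat.sum_antidiagonal_eq_sum_range_succ_mk,
    Nat.succ_eq_add_one, add_assoc, sum_range_add, sum_eq_zero, zero_add]
  · refine sum_congr rfl fun t _ => ?_
    rw [Nat.add_sub_add_left, mul_right_comm, choose_mul_natCast_choose, mul_assoc]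
  · intro j hj
    rw [Nat.choose_eq_zero_of_lt (mem_range.1 hj), Nat.cast_zero, mul_zero]

variable {X : Type*} [AddCommGroup X] [Module R X]

theorem sum_range_choose_mul_choose_smul_add (α β : R) (s : ℕ) {y : ℕ → X} {N : ℕ}
    (hy : ∀ m, N ≤ m → y m = 0) :
    ∑ j ∈ range N, ∑ k ∈ range N,
        (Ring.choose α j * Ring.choose β k * (j.choose s : R)) • y (j + k) =
      Ring.choose α s • ∑ m ∈ range N, Ring.choose (α + β - s) m • y (s + m) := by
  rw [sum_range_sum_range_smul_add
      (fun j k => Ring.choose α j * Ring.choose β k * (j.choose s : R)) hy,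
    sum_subset (range_subset_range.2 (Nat.le_add_left N s)) fun m _ hm => by
      rw [hy _ (by simpa using hm), smul_zero],
    sum_range_add, sum_eq_zero, zero_add, smul_sum]
  · refine sum_congr rfl fun m _ => ?_
    rw [sum_antidiagonal_choose_mul_choose, mul_smul]
  · intro m hm
    rw [sum_eq_zero, zero_smul]
    intro p hp
    have hlt : p.1 < s := by
      have := mem_antidiagonal.1 hp
      rw [mem_range] at hm
      omega
    rw [Nat.choose_eq_zero_of_lt hlt, Nat.cast_zero, mul_zero]

-- The coefficient extraction behind the expansion of `(z₀ + z₂) ^ n (1 + z₀ + z₂) ^ α (1 + z₂) ^ β`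
-- in nonnegative powers of `z₀`.
theorem sum_range_choose_add_smul (α β n : R) (i : ℕ) {y : ℕ → X} {N : ℕ}
    (hy : ∀ m, N ≤ m → y m = 0) :
    ∑ j ∈ range N, ∑ k ∈ range N,
        (Ring.choose α j * Ring.choose β k) • Ring.choose (n + j) i • y (j + k) =
      ∑ s ∈ antidiagonal i, (Ring.choose n s.2 * Ring.choose α s.1) •
        ∑ m ∈ range N, Ring.choose (α + β - s.1) m • y (s.1 + m) := by
  have hvandermonde : ∀ j k : ℕ,
      (Ring.choose α j * Ring.choose β k) • Ring.choose (n + j) i • y (j + k) =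
        ∑ s ∈ antidiagonal i, Ring.choose n s.2 •
          (Ring.choose α j * Ring.choose β k * (j.choose s.1 : R)) • y (j + k) := fun j k => by
    rw [add_comm n, Ring.add_choose_eq i (Commute.all _ _), sum_smul, smul_sum]
    refine sum_congr rfl fun s _ => ?_
    rw [Ring.choose_natCast]
    module
  simp only [hvandermonde]
  rw [sum_congr rfl fun j _ => sum_comm, sum_comm]
  refine sum_congr rfl fun s _ => ?_
  rw [mul_smul, ← sum_range_choose_mul_choose_smul_add α β s.1 hy]
  simp only [smul_sum]

end Binomial

theorem intCast_choose {R : Type*} [CommRing R] [BinomialRing R] (k : ℤ) (i : ℕ) :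
    ((Ring.choose k i : ℤ) : R) = Ring.choose (k : R) i := by
  simpa using Ring.map_choose (Int.castRingHom R) k i

theorem ratCast_choose {K : Type*} [DivisionRing K] [BinomialRing K] [CharZero K] (q : ℚ) (i : ℕ) :
    ((Ring.choose q i : ℚ) : K) = Ring.choose (q : K) i := by
  simpa using Ring.map_choose (Rat.castHom K) q i

theorem finsum_eq_sum_range {X : Type*} [AddCommMonoid X] {f : ℕ → X} {N : ℕ}
    (h : ∀ i, N ≤ i → f i = 0) : ∑ᶠ i, f i = ∑ i ∈ range N, f i :=
  finsum_eq_finsetSum_of_support_subset f fun i hi => by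
    by_contra hiN
    exact hi (h i (by simpa using hiN))

theorem eventually_forall_sub_add_eq_zero {X : Type*} [Zero X] {G : ℕ → ℤ → X}
    (h₁ : ∀ᶠ i in atTop, ∀ q, G i q = 0) (h₂ : ∀ i, ∀ᶠ q in atTop, G i q = 0) (q : ℤ) :
    ∀ᶠ N : ℕ in atTop, ∀ i m : ℕ, N ≤ m → G i (q - i + m) = 0 := by
  obtain ⟨K, hK⟩ := eventually_atTop.1 h₁
  choose Q hQ using fun i => eventually_atTop.1 (h₂ i)
  obtain ⟨B, hB⟩ := ((range K).image Q).bddAbove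
  filter_upwards [eventually_ge_atTop (B - q + K).toNat] with N hN i m hm
  rcases le_or_gt K i with hi | hi
  · exact hK i hi _
  · have hQB : Q i ≤ B := hB (mem_image_of_mem Q (mem_range.2 hi))
    exact hQ i _ (by omega)

/-! ### Residues of vertex operators -/

namespace VertexOperatorAlgebra

variable {V : Type*} [AddCommGroup V] [Module ℂ V] (A : VertexOperatorAlgebra V)

theorem eventually_mode_eq_zero (u v : V) : ∀ᶠ n in atTop, A.Y u n v = 0 :=
  eventually_atTop.2 (A.truncation u v)

theorem eventually_forall_mode_add_eq_zero (n : ℤ) (u v : V) :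
    ∀ᶠ N : ℕ in atTop, ∀ i : ℕ, N ≤ i → A.Y u (n + i) v = 0 := by
  obtain ⟨K, hK⟩ := A.truncation u v
  filter_upwards [eventually_ge_atTop (K - n).toNat] with N hN i hi
  exact hK _ (by omega)

theorem eventually_mode_mode_eq_zero (p q : ℤ) (u v c : V) :
    ∀ᶠ N : ℕ in atTop, ∀ i j k : ℕ, N ≤ j → A.Y u (q - i + j) (A.Y v (p + i + k) c) = 0 := by
  have h := eventually_forall_sub_add_eq_zero
    (G := fun i m => A.Y u m (A.Y v (p + i) c))
    (eventually_atTop.2 <| by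
      obtain ⟨N, hN⟩ := (A.eventually_forall_mode_add_eq_zero p v c).exists
      exact ⟨N, fun i hi m => by rw [hN i hi, map_zero]⟩)
    (fun i => A.eventually_mode_eq_zero u _) q
  filter_upwards [h] with N hN i j k hj
  have := hN (i + k) (j + k) (by omega)
  rwa [show q - (i + k : ℕ) + (j + k : ℕ) = q - i + j by push_cast; ring,
    show p + (i + k : ℕ) = p + i + k by push_cast; ring] at this

theorem eventually_iterate_eq_zero (l q : ℤ) (u v c : V) :
    ∀ᶠ N : ℕ in atTop, ∀ i m : ℕ, N ≤ m → A.Y (A.Y u (l + i) v) (q - i + m) c = 0 :=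
  eventually_forall_sub_add_eq_zero (G := fun i m => A.Y (A.Y u (l + i) v) m c)
    (eventually_atTop.2 <| by
      obtain ⟨N, hN⟩ := (A.eventually_forall_mode_add_eq_zero l u v).exists
      exact ⟨N, fun i hi m => by
        rw [hN i hi, map_zero, Pi.zero_apply, LinearMap.zero_apply]⟩)
    (fun i => A.eventually_mode_eq_zero _ c) q

theorem finite_support_smul_mode (f : ℕ → ℂ) (n : ℤ) (u v : V) :
    (Function.support fun i : ℕ => f i • A.Y u (n + i) v).Finite := by
  obtain ⟨N, hN⟩ := (A.eventually_forall_mode_add_eq_zero n u v).exists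
  refine (Set.finite_lt_nat N).subset fun i hi => ?_
  by_contra h
  exact hi (by simp only [hN i (not_lt.1 h), smul_zero])

/-- The residue `Res_z (1 + z) ^ α z ^ n Y(u, z) v`, where `(1 + z) ^ α` is expanded in nonnegative
powers of `z`. Both `u ∘_g v` and `u *_g v` are such residues. -/
def resMode (α : ℂ) (n : ℤ) : V →ₗ[ℂ] V →ₗ[ℂ] V :=
  LinearMap.mk₂ ℂ (fun u v => ∑ᶠ i : ℕ, Ring.choose α i • A.Y u (n + i) v)
    (fun u u' v => by
      rw [← finsum_add_distrib (A.finite_support_smul_mode _ n u v)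
        (A.finite_support_smul_mode _ n u' v)]
      simp)
    (fun c u v => by
      rw [smul_finsum]
      simp [smul_comm c])
    (fun u v v' => by
      rw [← finsum_add_distrib (A.finite_support_smul_mode _ n u v)
        (A.finite_support_smul_mode _ n u v')]
      simp)
    (fun c u v => by
      rw [smul_finsum]
      simp [smul_comm c])

theorem resMode_apply (α : ℂ) (n : ℤ) (u v : V) :
    A.resMode α n u v = ∑ᶠ i : ℕ, Ring.choose α i • A.Y u (n + i) v := rfl

theorem resMode_eq_sum {α : ℂ} {n : ℤ} {u v : V} {N : ℕ}
    (h : ∀ i : ℕ, N ≤ i → A.Y u (n + i) v = 0) :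
    A.resMode α n u v = ∑ i ∈ range N, Ring.choose α i • A.Y u (n + i) v := by
  rw [resMode_apply, finsum_eq_sum_range fun i hi => by rw [h i hi, smul_zero]]

theorem jacobi_sum {u v w : V} {l m n : ℤ} {N : ℕ} (hv : ∀ i : ℕ, N ≤ i → A.Y v (n + i) w = 0)
    (hu : ∀ i : ℕ, N ≤ i → A.Y u (m + i) w = 0) (huv : ∀ i : ℕ, N ≤ i → A.Y u (l + i) v = 0) :
    ∑ i ∈ range N, ((-1 : ℂ) ^ i * Ring.choose (l : ℂ) i) •
        (A.Y u (l + m - i) (A.Y v (n + i) w) -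
          (-1 : ℂ) ^ l • A.Y v (l + n - i) (A.Y u (m + i) w)) =
      ∑ i ∈ range N, Ring.choose (m : ℂ) i • A.Y (A.Y u (l + i) v) (m + n - i) w := by
  have h := A.jacobi u v w l m n
  simp only [intCast_choose] at h
  rwa [finsum_eq_sum_range fun i hi => by
      rw [hv i hi, hu i hi, map_zero, map_zero, smul_zero, sub_zero, smul_zero],
    finsum_eq_sum_range fun i hi => by
      rw [huv i hi, map_zero, Pi.zero_apply, LinearMap.zero_apply, smul_zero]] at h

theorem resMode_resMode_eq_sum (α β : ℂ) {q p : ℤ} {u v c : V} {N : ℕ}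
    (hv : ∀ k : ℕ, N ≤ k → A.Y v (p + k) c = 0)
    (h : ∀ j k : ℕ, N ≤ j → A.Y u (q + j) (A.Y v (p + k) c) = 0) :
    A.resMode α q u (A.resMode β p v c) = ∑ j ∈ range N, ∑ k ∈ range N,
      (Ring.choose α j * Ring.choose β k) • A.Y u (q + j) (A.Y v (p + k) c) := by
  rw [A.resMode_eq_sum hv, map_sum, sum_comm]
  refine sum_congr rfl fun k _ => ?_
  rw [map_smul, A.resMode_eq_sum fun j hj => h j k hj, smul_sum]
  refine sum_congr rfl fun j _ => ?_
  rw [smul_smul, mul_comm]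

theorem eventually_resMode_sub_resMode_eq_sum (α β ε : ℂ) (l n p : ℤ) (u v c : V) :
    ∀ᶠ N in atTop, ∀ i : ℕ,
      A.resMode α (l + n - i) u (A.resMode β (p + i) v c) -
          ε • A.resMode β (l + p - i) v (A.resMode α (n + i) u c) =
        ∑ j ∈ range N, ∑ k ∈ range N, (Ring.choose α j * Ring.choose β k) •
          (A.Y u (l + (n + j) - i) (A.Y v (p + k + i) c) -
            ε • A.Y v (l + (p + k) - i) (A.Y u (n + j + i) c)) := by
  filter_upwards [A.eventually_forall_mode_add_eq_zero p v c,
    A.eventually_forall_mode_add_eq_zero n u c, A.eventually_mode_mode_eq_zero p (l + n) u v c,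
    A.eventually_mode_mode_eq_zero n (l + p) v u c] with N hv hu huv hvu i
  rw [A.resMode_resMode_eq_sum α β (fun k hk => by
        rw [add_assoc, ← Nat.cast_add]; exact hv _ (by omega)) (fun j k hj => huv i j k hj),
    A.resMode_resMode_eq_sum β α (fun k hk => by
        rw [add_assoc, ← Nat.cast_add]; exact hu _ (by omega)) (fun j k hj => hvu i j k hj),
    sum_comm (f := fun j k => (Ring.choose β j * Ring.choose α k) • _), smul_sum,
    ← sum_sub_distrib]
  refine sum_congr rfl fun j _ => ?_
  rw [smul_sum, ← sum_sub_distrib]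
  refine sum_congr rfl fun k _ => ?_
  rw [show l + (n + j) - i = l + n - (i : ℤ) + j by ring, add_right_comm p,
    show l + (p + k) - i = l + p - (i : ℤ) + k by ring, add_right_comm n,
    mul_comm (Ring.choose β k)]
  module

theorem eventually_sum_iterate_eq_resMode (α β : ℂ) (l n p : ℤ) (u v c : V) :
    ∀ᶠ N in atTop, ∀ i : ℕ,
      ∑ j ∈ range N, ∑ k ∈ range N, (Ring.choose α j * Ring.choose β k) •
          Ring.choose ((n + j : ℤ) : ℂ) i • A.Y (A.Y u (l + i) v) (n + j + (p + k) - i) c =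
        ∑ s ∈ antidiagonal i, (Ring.choose (n : ℂ) s.2 * Ring.choose α s.1) •
          A.resMode (α + β - s.1) (n + p - s.2) (A.Y u (l + i) v) c := by
  filter_upwards [A.eventually_iterate_eq_zero l (n + p) u v c] with N hN i
  refine Eq.trans (sum_congr rfl fun j _ => sum_congr rfl fun k _ => ?_)
    ((sum_range_choose_add_smul α β (n : ℂ) i (hN i)).trans (sum_congr rfl fun s hs => ?_))
  · rw [show n + j + (p + k) - i = n + p - i + (j + k : ℕ) by push_cast; ring, Int.cast_add,
      Int.cast_natCast]
  · have hm : ∀ m : ℕ, n + p - i + (s.1 + m : ℕ) = n + p - s.2 + m := fun m => by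
      rw [← mem_antidiagonal.1 hs]; push_cast; ring
    simp only [hm]
    rw [A.resMode_eq_sum (N := N) fun m hmN => by rw [← hm]; exact hN i _ (by omega)]

-- The Jacobi identity paired with `(1 + z₁) ^ α z₁ ^ n (1 + z₂) ^ β z₂ ^ p (z₁ - z₂) ^ l`.
theorem resMode_jacobi (α β : ℂ) (l n p : ℤ) (u v c : V) : ∀ᶠ N in atTop,
    ∑ i ∈ range N, ((-1 : ℂ) ^ i * Ring.choose (l : ℂ) i) •
        (A.resMode α (l + n - i) u (A.resMode β (p + i) v c) -
          (-1 : ℂ) ^ l • A.resMode β (l + p - i) v (A.resMode α (n + i) u c)) =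
      ∑ i ∈ range N, ∑ s ∈ antidiagonal i, (Ring.choose (n : ℂ) s.2 * Ring.choose α s.1) •
        A.resMode (α + β - s.1) (n + p - s.2) (A.Y u (l + i) v) c := by
  filter_upwards [A.eventually_resMode_sub_resMode_eq_sum α β ((-1) ^ l) l n p u v c,
    A.eventually_sum_iterate_eq_resMode α β l n p u v c,
    A.eventually_forall_mode_add_eq_zero p v c, A.eventually_forall_mode_add_eq_zero n u c,
    A.eventually_forall_mode_add_eq_zero l u v] with N hleft hright hv hu huv
  have hjacobi := fun j k : ℕ => A.jacobi_sum (l := l) (m := n + j) (n := p + k) (w := c)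
    (fun i hi => by rw [add_assoc, ← Nat.cast_add]; exact hv _ (by omega))
    (fun i hi => by rw [add_assoc, ← Nat.cast_add]; exact hu _ (by omega)) huv
  calc
    _ = ∑ j ∈ range N, ∑ k ∈ range N, (Ring.choose α j * Ring.choose β k) •
          ∑ i ∈ range N, ((-1 : ℂ) ^ i * Ring.choose (l : ℂ) i) •
            (A.Y u (l + (n + j) - i) (A.Y v (p + k + i) c) -
              (-1 : ℂ) ^ l • A.Y v (l + (p + k) - i) (A.Y u (n + j + i) c)) := by
      simp only [hleft, smul_sum]
      rw [sum_comm]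
      refine sum_congr rfl fun j _ => ?_
      rw [sum_comm]
      exact sum_congr rfl fun k _ => sum_congr rfl fun i _ => smul_comm _ _ _
    _ = ∑ j ∈ range N, ∑ k ∈ range N, (Ring.choose α j * Ring.choose β k) •
          ∑ i ∈ range N, Ring.choose ((n + j : ℤ) : ℂ) i •
            A.Y (A.Y u (l + i) v) (n + j + (p + k) - i) c := by
      simp only [hjacobi]
    _ = _ := by
      simp only [← hright, smul_sum]
      rw [sum_congr rfl fun j _ => sum_comm, sum_comm]

theorem resMode_commutator (α β : ℂ) (n p : ℤ) (u v c : V) : ∀ᶠ N in atTop,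
    A.resMode α n u (A.resMode β p v c) - A.resMode β p v (A.resMode α n u c) =
      ∑ i ∈ range N, ∑ s ∈ antidiagonal i, (Ring.choose (n : ℂ) s.2 * Ring.choose α s.1) •
        A.resMode (α + β - s.1) (n + p - s.2) (A.Y u i v) c := by
  filter_upwards [A.resMode_jacobi α β 0 n p u v c, eventually_gt_atTop 0] with N hN hpos
  rw [sum_eq_single_of_mem 0 (mem_range.2 hpos) fun i _ hi => by
    rw [Int.cast_zero, Ring.choose_zero_pos ℂ (Nat.pos_of_ne_zero hi), mul_zero, zero_smul]] at hN
  simpa using hN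

theorem resMode_iterate (α β : ℂ) (l p : ℤ) (u v c : V) : ∀ᶠ N in atTop,
    ∑ i ∈ range N, Ring.choose α i • A.resMode (α + β - i) p (A.Y u (l + i) v) c =
      ∑ i ∈ range N, ((-1 : ℂ) ^ i * Ring.choose (l : ℂ) i) •
        (A.resMode α (l - i) u (A.resMode β (p + i) v c) -
          (-1 : ℂ) ^ l • A.resMode β (l + p - i) v (A.resMode α i u c)) := by
  filter_upwards [A.resMode_jacobi α β l 0 p u v c] with N hN
  simp only [add_zero, zero_add] at hN
  rw [hN]
  refine sum_congr rfl fun i _ => ?_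
  rw [sum_eq_single_of_mem (i, 0) (mem_antidiagonal.2 (add_zero i))]
  · simp
  · intro s hs hne
    have hs2 : s.2 ≠ 0 := fun h => hne (Prod.ext (by simpa [h] using hs) h)
    rw [Int.cast_zero, Ring.choose_zero_pos ℂ (Nat.pos_of_ne_zero hs2), zero_mul, zero_smul]

end VertexOperatorAlgebra

/-! ### Eigenspaces of an automorphism of finite order -/

section Twist

theorem sum_range_pow_pow_eq_ite {R : Type*} [CommRing R] [IsDomain R] {ζ : R} {T i : ℕ}
    (hζ : IsPrimitiveRoot ζ T) (hi : i < T) :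
    ∑ r ∈ range T, (ζ ^ i) ^ r = if i = 0 then (T : R) else 0 := by
  split_ifs with h0
  · simp [h0]
  · have h := mul_neg_geom_sum (ζ ^ i) T
    rw [← pow_mul, mul_comm i, pow_mul, hζ.pow_eq_one, one_pow, sub_self] at h
    exact (mul_eq_zero.1 h).resolve_left
      (sub_ne_zero.2 (hζ.pow_ne_one_of_pos_of_lt h0 hi).symm)

variable {V : Type*} [AddCommGroup V] [Module ℂ V] {T : ℕ} {g : V ≃ₗ[ℂ] V}

theorem mem_twistEigenspace {r : ℕ} {v : V} :
    v ∈ twistEigenspace T g r ↔ g v = Complex.exp (2 * Real.pi * Complex.I / T) ^ r • v := by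
  rw [twistEigenspace, Module.End.mem_eigenspace_iff, ← Complex.exp_nat_mul,
    show 2 * (Real.pi : ℂ) * Complex.I * r / T = r * (2 * Real.pi * Complex.I / T) by ring]
  rfl

theorem mem_twistEigenspace_zero {v : V} : v ∈ twistEigenspace T g 0 ↔ g v = v := by
  rw [mem_twistEigenspace, pow_zero, one_smul]

theorem twistEigenspace_mod (hT : 0 < T) (r : ℕ) :
    twistEigenspace T g (r % T) = twistEigenspace T g r := by
  ext v
  rw [mem_twistEigenspace, mem_twistEigenspace,
    ← pow_eq_pow_mod r (Complex.isPrimitiveRoot_exp T hT.ne').pow_eq_one]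

/-- The projection of `V` onto `V^r` along the other eigenspaces of `g`, as the average of the
powers of `e^(-2πir/T) g`. -/
def twistProj (T : ℕ) (g : V ≃ₗ[ℂ] V) (r : ℕ) : Module.End ℂ V :=
  (T : ℂ)⁻¹ • ∑ i ∈ range T,
    ((Complex.exp (2 * Real.pi * Complex.I / T) ^ r)⁻¹ • (g : Module.End ℂ V)) ^ i

theorem twistProj_apply (r : ℕ) (v : V) : twistProj T g r v =
    (T : ℂ)⁻¹ • ∑ i ∈ range T, ((Complex.exp (2 * Real.pi * Complex.I / T) ^ r)⁻¹) ^ i •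
      ((g : Module.End ℂ V) ^ i) v := by
  simp [twistProj, smul_pow]

theorem twistProj_mem (hT : 0 < T) (hgT : g ^ T = 1) (r : ℕ) (v : V) :
    twistProj T g r v ∈ twistEigenspace T g r := by
  have hζ := (Complex.isPrimitiveRoot_exp T hT.ne').pow_eq_one
  set ζ := Complex.exp (2 * Real.pi * Complex.I / T)
  have hζr : ζ ^ r ≠ 0 := pow_ne_zero _ (Complex.exp_ne_zero _)
  have hpow : ((ζ ^ r)⁻¹ • (g : Module.End ℂ V)) ^ T = 1 := by
    have hg := congrArg (LinearEquiv.automorphismGroup.toLinearMapMonoidHom (R := ℂ) (M := V)) hgT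
    rw [map_pow, map_one] at hg
    rw [smul_pow, inv_pow, pow_right_comm, hζ, one_pow, inv_one, one_smul]
    exact hg
  have hfix : ((ζ ^ r)⁻¹ • (g : Module.End ℂ V)) * twistProj T g r = twistProj T g r := by
    have h := mul_geom_sum ((ζ ^ r)⁻¹ • (g : Module.End ℂ V)) T
    rw [hpow, sub_self, sub_mul, one_mul, sub_eq_zero] at h
    rw [twistProj, mul_smul_comm, h]
  rw [mem_twistEigenspace, ← inv_smul_eq_iff₀ hζr]
  exact DFunLike.congr_fun hfix v

theorem sum_twistProj_apply (hT : 0 < T) (v : V) : ∑ r ∈ range T, twistProj T g r v = v := by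
  have hζ := (Complex.isPrimitiveRoot_exp T hT.ne').inv
  have hswap : ∀ i r : ℕ, ((Complex.exp (2 * Real.pi * Complex.I / T) ^ r)⁻¹) ^ i =
      ((Complex.exp (2 * Real.pi * Complex.I / T))⁻¹ ^ i) ^ r := fun i r => by
    rw [← inv_pow, pow_right_comm]
  simp only [twistProj_apply, hswap]
  rw [← smul_sum, sum_comm, sum_eq_single_of_mem 0 (mem_range.2 hT)]
  · rw [← sum_smul, sum_range_pow_pow_eq_ite hζ hT, if_pos rfl, pow_zero, Module.End.one_apply,
      inv_smul_smul₀ (Nat.cast_ne_zero.2 hT.ne')]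
  · intro i hi h0
    rw [← sum_smul, sum_range_pow_pow_eq_ite hζ (mem_range.1 hi), if_neg h0, zero_smul]

theorem pow_apply_of_mem_twistEigenspace {r : ℕ} {v : V} (hv : v ∈ twistEigenspace T g r)
    (i : ℕ) : ((g : Module.End ℂ V) ^ i) v =
      (Complex.exp (2 * Real.pi * Complex.I / T) ^ r) ^ i • v := by
  rw [mem_twistEigenspace] at hv
  induction i with
  | zero => simp
  | succ i ih => rw [pow_succ', Module.End.mul_apply, ih, map_smul, LinearEquiv.coe_coe, hv,
      smul_smul, ← pow_succ]

theorem twistProj_zero_apply (hT : 0 < T) {r : ℕ} (hr : r < T) {v : V}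
    (hv : v ∈ twistEigenspace T g r) : twistProj T g 0 v = if r = 0 then v else 0 := by
  simp only [twistProj_apply, pow_zero, inv_one, one_pow, one_smul,
    pow_apply_of_mem_twistEigenspace hv]
  rw [← sum_smul, sum_range_pow_pow_eq_ite (Complex.isPrimitiveRoot_exp T hT.ne') hr, smul_smul]
  split_ifs
  · rw [inv_mul_cancel₀ (Nat.cast_ne_zero.2 hT.ne'), one_smul]
  · rw [mul_zero, zero_smul]

end Twist

/-! ### Weights and the product `*_g` -/

namespace VertexOperatorAlgebra

variable {V : Type*} [AddCommGroup V] [Module ℂ V] (A : VertexOperatorAlgebra V)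
  {X : Type*} [AddCommGroup X] [Module ℂ X]

section Weight

theorem mem_weightSpace {k : ℤ} {v : V} : v ∈ A.weightSpace k ↔ A.Y A.omega 1 v = (k : ℂ) • v :=
  Module.End.mem_eigenspace_iff

theorem vac_mem_weightSpace : A.vac ∈ A.weightSpace 0 := by
  rw [mem_weightSpace, A.creation_regular _ _ zero_le_one, Int.cast_zero, zero_smul]

theorem omega_one_mode_apply (u v : V) (n : ℤ) :
    A.Y A.omega 1 (A.Y u n v) =
      A.Y u n (A.Y A.omega 1 v) + A.Y (A.Y A.omega 1 u) n v - ((n : ℂ) + 1) • A.Y u n v := by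
  have h := A.jacobi A.omega u v 0 1 n
  have hchoose : ∀ i : ℕ, 2 ≤ i → Ring.choose (1 : ℤ) i = 0 := fun i hi => by
    simpa [Nat.choose_eq_zero_of_lt hi] using Ring.choose_natCast (R := ℤ) 1 i
  rw [finsum_eq_single _ 0 fun i hi => by
      rw [Ring.choose_zero_pos ℤ (Nat.pos_of_ne_zero hi), Int.cast_zero, mul_zero, zero_smul],
    finsum_eq_sum_range (N := 2) fun i hi => by rw [hchoose i hi, Int.cast_zero, zero_smul],
    sum_range_succ, sum_range_one] at h
  simp only [Ring.choose_zero_right, Ring.choose_one_right, Nat.cast_zero, Nat.cast_one,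
    zero_add, add_zero, sub_zero, pow_zero, zpow_zero, Int.cast_one, mul_one, one_smul,
    add_sub_cancel_left, LinearMap.smul_apply, A.derivative, sub_eq_iff_eq_add] at h
  rw [h]
  push_cast
  module

theorem mode_mem_weightSpace {k j : ℤ} {u v : V} (hu : u ∈ A.weightSpace k)
    (hv : v ∈ A.weightSpace j) (n : ℤ) : A.Y u n v ∈ A.weightSpace (k + j - n - 1) := by
  rw [mem_weightSpace] at *
  rw [omega_one_mode_apply, hu, hv]
  simp only [map_smul, LinearMap.smul_apply, Pi.smul_apply]
  push_cast
  module

theorem derivation_mem_weightSpace {k : ℤ} {u : V} (hu : u ∈ A.weightSpace k) :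
    A.Y A.omega 0 u ∈ A.weightSpace (k + 1) := by
  have h : A.Y A.omega 1 (A.Y A.omega 0 u) - A.Y A.omega 0 (A.Y A.omega 1 u) =
      A.Y A.omega 0 u := by
    simpa using congrArg (fun f : Module.End ℂ V => f u) (A.virasoro 0 (-1))
  rw [mem_weightSpace] at *
  rw [sub_eq_iff_eq_add.1 h, hu, map_smul, Int.cast_add, Int.cast_one, add_smul, one_smul, add_comm]

instance : DirectSum.Decomposition A.weightSpace :=
  DirectSum.IsInternal.chooseDecomposition _ A.grading

theorem map_mem_of_forall_weightSpace (f : V →ₗ[ℂ] X) {N : Submodule ℂ X}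
    (h : ∀ k, ∀ u ∈ A.weightSpace k, f u ∈ N) (v : V) : f v ∈ N := by
  have hle : ⨆ k, A.weightSpace k ≤ N.comap f := iSup_le fun k u hu => h k u hu
  exact hle (A.grading.submodule_iSup_eq_top.ge trivial)

/-- The linear map on `V` given by `φ k` on the homogeneous vectors of weight `k`. It encodes
formulas whose exponents involve `wt u`. -/
def weightwise (φ : ℤ → V →ₗ[ℂ] X) : V →ₗ[ℂ] X :=
  DirectSum.toModule ℂ ℤ X (fun k => φ k ∘ₗ (A.weightSpace k).subtype) ∘ₗ
    (DirectSum.decomposeLinearEquiv A.weightSpace : V →ₗ[ℂ] _)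

theorem weightwise_apply (φ : ℤ → V →ₗ[ℂ] X) {k : ℤ} {u : V} (hu : u ∈ A.weightSpace k) :
    A.weightwise φ u = φ k u := by
  lift u to A.weightSpace k using hu
  rw [weightwise, LinearMap.comp_apply, LinearEquiv.coe_coe,
    DirectSum.decomposeLinearEquiv_apply_coe, DirectSum.toModule_lof]
  rfl

end Weight

section Twist

variable {A} {T : ℕ} {g : V ≃ₗ[ℂ] V}

theorem IsAutomorphism.mode_mem_twistEigenspace (hg : A.IsAutomorphism g) {r s : ℕ} {u v : V}
    (hu : u ∈ twistEigenspace T g r) (hv : v ∈ twistEigenspace T g s) (n : ℤ) :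
    A.Y u n v ∈ twistEigenspace T g (r + s) := by
  rw [mem_twistEigenspace] at *
  simp only [hg.map_mode, hu, hv, map_smul, LinearMap.smul_apply, Pi.smul_apply, smul_smul,
    pow_add, mul_comm]

theorem IsAutomorphism.mode_mem_twistEigenspace_of_zero (hg : A.IsAutomorphism g) {r : ℕ}
    {u v : V} (hu : u ∈ twistEigenspace T g 0) (hv : v ∈ twistEigenspace T g r) (n : ℤ) :
    A.Y u n v ∈ twistEigenspace T g r := by
  simpa only [zero_add] using hg.mode_mem_twistEigenspace hu hv n

theorem IsAutomorphism.vac_mem_twistEigenspace (hg : A.IsAutomorphism g) :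
    A.vac ∈ twistEigenspace T g 0 :=
  mem_twistEigenspace_zero.2 hg.map_vac

theorem IsAutomorphism.derivation_mem_twistEigenspace (hg : A.IsAutomorphism g) {r : ℕ} {u : V}
    (hu : u ∈ twistEigenspace T g r) : A.Y A.omega 0 u ∈ twistEigenspace T g r :=
  hg.mode_mem_twistEigenspace_of_zero (mem_twistEigenspace_zero.2 hg.map_omega) hu 0

theorem IsAutomorphism.apply_mem_weightSpace (hg : A.IsAutomorphism g) {k : ℤ} {u : V}
    (hu : u ∈ A.weightSpace k) : g u ∈ A.weightSpace k := by
  rw [mem_weightSpace] at *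
  rw [← map_smul, ← hu, hg.map_mode, hg.map_omega]

theorem IsAutomorphism.twistProj_mem_weightSpace (hg : A.IsAutomorphism g) (r : ℕ) {k : ℤ} {u : V}
    (hu : u ∈ A.weightSpace k) : twistProj T g r u ∈ A.weightSpace k := by
  rw [twistProj_apply]
  exact Submodule.smul_mem _ _ (Submodule.sum_mem _ fun i _ => Submodule.smul_mem _ _
    (Module.End.pow_apply_mem_of_forall_mem i (fun _ => hg.apply_mem_weightSpace) u hu))

theorem IsAutomorphism.map_mem_of_forall_homogeneous (hg : A.IsAutomorphism g) (hT : 0 < T)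
    (hgT : g ^ T = 1) (f : V →ₗ[ℂ] X) {N : Submodule ℂ X}
    (h : ∀ r < T, ∀ k, ∀ u ∈ twistEigenspace T g r, u ∈ A.weightSpace k → f u ∈ N) (v : V) :
    f v ∈ N := by
  refine A.map_mem_of_forall_weightSpace f (fun k u hu => ?_) v
  rw [← sum_twistProj_apply (g := g) hT u, map_sum]
  exact Submodule.sum_mem _ fun r hr => h r (mem_range.1 hr) k _ (twistProj_mem hT hgT r u)
    (hg.twistProj_mem_weightSpace r hu)

end Twist

section Star

variable {A} {T : ℕ} {g : V ≃ₗ[ℂ] V}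

variable (A T g) in
/-- The bilinear product `*_g` on `V`, obtained from its values on homogeneous eigenvectors of `g`
in the first argument by first projecting to `V^0`. -/
def star : V →ₗ[ℂ] V →ₗ[ℂ] V :=
  A.weightwise (fun k => A.resMode k (-1)) ∘ₗ twistProj T g 0

theorem star_apply_zero (hT : 0 < T) {k : ℤ} {u : V} (hu : u ∈ twistEigenspace T g 0)
    (hk : u ∈ A.weightSpace k) : A.star T g u = A.resMode k (-1) u := by
  rw [star, LinearMap.comp_apply, twistProj_zero_apply hT hT hu, if_pos rfl,
    A.weightwise_apply _ hk]

theorem star_apply_of_ne_zero (hT : 0 < T) {r : ℕ} (hr : r < T) (h0 : r ≠ 0) {u : V}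
    (hu : u ∈ twistEigenspace T g r) : A.star T g u = 0 := by
  rw [star, LinearMap.comp_apply, twistProj_zero_apply hT hr hu, if_neg h0, map_zero]

theorem star_eq_starProd (hT : 0 < T) {r : ℕ} (hr : r < T) {k : ℤ} {u : V}
    (hu : u ∈ twistEigenspace T g r) (hk : u ∈ A.weightSpace k) (v : V) :
    A.star T g u v = starProd A r k u v := by
  rw [starProd]
  split_ifs with h0
  · subst h0
    simp only [star_apply_zero hT hu hk, resMode_apply, intCast_choose, sub_eq_neg_add]
  · rw [star_apply_of_ne_zero hT hr h0 hu, LinearMap.zero_apply]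

end Star

section Residue

theorem resMode_add_one (α : ℂ) (n : ℤ) (u v : V) :
    A.resMode (α + 1) n u v = A.resMode α n u v + A.resMode α (n + 1) u v := by
  obtain ⟨N, hN⟩ := (A.eventually_forall_mode_add_eq_zero n u v).exists
  have hshift : ∀ i : ℕ, n + 1 + (i : ℤ) = n + (i + 1 : ℕ) := fun i => by push_cast; ring
  rw [A.resMode_eq_sum (N := N + 1) fun i hi => hN i (by omega),
    A.resMode_eq_sum (N := N + 1) fun i hi => hN i (by omega),
    A.resMode_eq_sum (N := N) fun i hi => by rw [hshift]; exact hN _ (by omega),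
    sum_range_succ', sum_range_succ', Ring.choose_zero_right, Ring.choose_zero_right,
    add_right_comm, ← sum_add_distrib]
  congr 1
  refine sum_congr rfl fun i _ => ?_
  rw [hshift, Ring.choose_succ_succ, add_smul, add_comm]

theorem smul_resMode_sub_one (β : ℂ) {p : ℤ} {u v : V} {N : ℕ}
    (hN : ∀ i : ℕ, N ≤ i → A.Y u (p + i) v = 0) :
    β • A.resMode (β - 1) (p + 1) u v =
      ∑ i ∈ range (N + 1), ((i : ℂ) * Ring.choose β i) • A.Y u (p + i) v := by
  have hshift : ∀ i : ℕ, p + 1 + (i : ℤ) = p + (i + 1 : ℕ) := fun i => by push_cast; ring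
  rw [A.resMode_eq_sum (N := N) fun i hi => by rw [hshift]; exact hN _ (by omega),
    sum_range_succ', Nat.cast_zero, zero_mul, zero_smul, add_zero, smul_sum]
  refine sum_congr rfl fun i _ => ?_
  rw [hshift, smul_smul, ← succ_mul_choose_succ, ← Nat.cast_succ (R := ℂ)]

-- Integration by parts for `Y(L(-1)u, z) = d/dz Y(u, z)`.
theorem resMode_derivation (β : ℂ) (p : ℤ) (u v : V) :
    A.resMode β (p + 1) (A.Y A.omega 0 u) v =
      -((p : ℂ) + 1) • A.resMode β p u v - β • A.resMode (β - 1) (p + 1) u v := by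
  obtain ⟨N, hN⟩ := (A.eventually_forall_mode_add_eq_zero p u v).exists
  have hderiv : ∀ i : ℕ, A.Y (A.Y A.omega 0 u) (p + 1 + i) v =
      (-((p + 1 + i : ℤ) : ℂ)) • A.Y u (p + i) v := fun i => by
    rw [A.derivative, show p + 1 + (i : ℤ) - 1 = p + i by ring, LinearMap.smul_apply]
  rw [A.smul_resMode_sub_one β hN, A.resMode_eq_sum (N := N + 1) fun i hi => hN i (by omega),
    A.resMode_eq_sum (N := N + 1) fun i hi => by rw [hderiv, hN i (by omega), smul_zero],
    smul_sum, ← sum_sub_distrib]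
  refine sum_congr rfl fun i _ => ?_
  rw [hderiv]
  push_cast
  module

end Residue

end VertexOperatorAlgebra

/-! ### The algebra `A_g(V)` -/

/-- The symbol `δ_r` in the exponents that define `u ∘_g v`; an integer, as those of `z` are. -/
def twistDelta (r : ℕ) : ℤ := if r = 0 then 1 else 0

/-- The exponent of `1 + z` in the definition of `u ∘_g v` for `u ∈ V^r` of weight `k`. -/
def circExp (T r : ℕ) (k : ℤ) : ℂ := k - 1 + twistDelta r + (r : ℂ) / T

theorem twistDelta_zero : twistDelta 0 = 1 := if_pos rfl

theorem twistDelta_of_ne_zero {r : ℕ} (h : r ≠ 0) : twistDelta r = 0 := if_neg h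

theorem twistDelta_nonneg (r : ℕ) : 0 ≤ twistDelta r := by
  unfold twistDelta; split_ifs <;> decide

theorem circExp_zero (T : ℕ) (k : ℤ) : circExp T 0 k = k := by simp [circExp, twistDelta_zero]

theorem circExp_add (T r : ℕ) (k j : ℤ) : circExp T r (k + j) = circExp T r k + j := by
  simp only [circExp]; push_cast; ring

theorem eq_zero_and_eq_zero_or_add_eq_of_dvd {T r s : ℕ} (hr : r < T) (hs : s < T)
    (h : T ∣ r + s) : r = 0 ∧ s = 0 ∨ r ≠ 0 ∧ s ≠ 0 ∧ r + s = T := by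
  rcases Nat.eq_zero_or_pos (r + s) with h0 | h0
  · omega
  · have := Nat.eq_of_dvd_of_lt_two_mul h0.ne' h (by omega)
    omega

theorem twistDelta_eq_of_dvd {T r s : ℕ} (hr : r < T) (hs : s < T) (h : T ∣ r + s) :
    twistDelta r = twistDelta s := by
  rcases eq_zero_and_eq_zero_or_add_eq_of_dvd hr hs h with ⟨rfl, rfl⟩ | ⟨hr0, hs0, -⟩
  · rfl
  · rw [twistDelta_of_ne_zero hr0, twistDelta_of_ne_zero hs0]

theorem circExp_add_circExp_of_dvd {T r s : ℕ} (hr : r < T) (hs : s < T) (h : T ∣ r + s)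
    (k j : ℤ) : circExp T r k + circExp T s j + 1 = k + j + twistDelta r := by
  rcases eq_zero_and_eq_zero_or_add_eq_of_dvd hr hs h with ⟨rfl, rfl⟩ | ⟨hr0, hs0, hrs⟩
  · simp only [circExp_zero, twistDelta_zero, Int.cast_one]
  · have hT : (T : ℂ) ≠ 0 := Nat.cast_ne_zero.2 (by omega)
    have hdiv : (r : ℂ) / T + (s : ℂ) / T = 1 := by
      rw [← add_div, ← Nat.cast_add, hrs, div_self hT]
    simp only [circExp, twistDelta_of_ne_zero hr0, twistDelta_of_ne_zero hs0, Int.cast_zero]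
    linear_combination hdiv

namespace VertexOperatorAlgebra

variable {V : Type*} [AddCommGroup V] [Module ℂ V] {A : VertexOperatorAlgebra V} {T : ℕ}
  {g : V ≃ₗ[ℂ] V}

theorem circProd_eq_resMode (r : ℕ) (k : ℤ) (u v : V) :
    circProd A T r k u v = A.resMode (circExp T r k) (-1 - twistDelta r) u v := by
  rw [resMode_apply]
  refine finsum_congr fun i => ?_
  rw [ratCast_choose, show -1 - twistDelta r + (i : ℤ) = i - 1 - twistDelta r by ring]
  simp only [circExp, twistDelta]
  split_ifs <;> push_cast <;> rfl

section OgSubmodule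

theorem resMode_circExp_mem_OgSubmodule (hg : A.IsAutomorphism g) {r : ℕ} (hr : r < T) (v : V)
    (m : ℕ) {k : ℤ} {u : V} (hu : u ∈ twistEigenspace T g r) (hk : u ∈ A.weightSpace k) :
    A.resMode (circExp T r k) (-1 - twistDelta r - m) u v ∈ OgSubmodule A T g := by
  induction m generalizing k u with
  | zero =>
    refine Submodule.subset_span ⟨r, k, u, v, hr, hu, hk, ?_⟩
    rw [circProd_eq_resMode, Nat.cast_zero, sub_zero]
  | succ m ih =>
    have hp : -1 - twistDelta r - m = -1 - twistDelta r - (m + 1 : ℕ) + 1 := by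
      push_cast; ring
    have hne : ((-1 - twistDelta r - (m + 1 : ℕ) : ℤ) : ℂ) + 1 ≠ 0 := by
      have := twistDelta_nonneg r
      exact_mod_cast (by omega : -1 - twistDelta r - (m + 1 : ℕ) + 1 ≠ 0)
    have hder := ih (hg.derivation_mem_twistEigenspace hu) (A.derivation_mem_weightSpace hk)
    have hu' := ih hu hk
    rw [hp] at hder hu'
    rw [resMode_derivation, circExp_add, Int.cast_one, add_sub_cancel_right,
      A.resMode_add_one, smul_add] at hder
    rw [← Submodule.smul_mem_iff _ (neg_ne_zero.2 hne)]
    have := Submodule.add_mem _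
      (Submodule.add_mem _ hder (Submodule.smul_mem _ (circExp T r k + 1) hu'))
      (Submodule.smul_mem _ (((-1 - twistDelta r - (m + 1 : ℕ) : ℤ) : ℂ) + 1) hu')
    convert this using 1
    module

theorem resMode_circExp_add_mem_OgSubmodule (hg : A.IsAutomorphism g) {r : ℕ} (hr : r < T) {k : ℤ}
    {u : V} (hu : u ∈ twistEigenspace T g r) (hk : u ∈ A.weightSpace k) (v : V) {n m : ℕ}
    (hnm : n ≤ m) :
    A.resMode (circExp T r k + n) (-1 - twistDelta r - m) u v ∈ OgSubmodule A T g := by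
  induction n generalizing m with
  | zero =>
    rw [Nat.cast_zero, add_zero]
    exact resMode_circExp_mem_OgSubmodule hg hr v m hu hk
  | succ n ih =>
    obtain ⟨m, rfl⟩ : ∃ m', m = m' + 1 := ⟨m - 1, by omega⟩
    rw [Nat.cast_succ, ← add_assoc, A.resMode_add_one,
      show -1 - twistDelta r - (m + 1 : ℕ) + 1 = -1 - twistDelta r - m by push_cast; ring]
    exact Submodule.add_mem _ (ih (by omega)) (ih (by omega))

theorem mem_OgSubmodule_of_ne_zero {r : ℕ} (hr : r < T) (h0 : r ≠ 0) {k : ℤ} {u : V}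
    (hu : u ∈ twistEigenspace T g r) (hk : u ∈ A.weightSpace k) : u ∈ OgSubmodule A T g := by
  refine Submodule.subset_span ⟨r, k, u, A.vac, hr, hu, hk, ?_⟩
  rw [circProd_eq_resMode, twistDelta_of_ne_zero h0,
    A.resMode_eq_sum (N := 1) fun i hi => A.creation_regular _ _ (by omega), sum_range_one,
    Ring.choose_zero_right, one_smul, sub_zero, Nat.cast_zero, add_zero, A.creation]

theorem map_mem_of_mem_OgSubmodule (hg : A.IsAutomorphism g) (hT : 0 < T) (hgT : g ^ T = 1)
    {X : Type*} [AddCommGroup X] [Module ℂ X] (f : V →ₗ[ℂ] X) {N : Submodule ℂ X}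
    (h : ∀ r < T, ∀ s < T, ∀ k j u w, u ∈ twistEigenspace T g r → u ∈ A.weightSpace k →
      w ∈ twistEigenspace T g s → w ∈ A.weightSpace j →
        f (A.resMode (circExp T r k) (-1 - twistDelta r) u w) ∈ N) {x : V}
    (hx : x ∈ OgSubmodule A T g) : f x ∈ N := by
  have hle : OgSubmodule A T g ≤ N.comap f := by
    refine Submodule.span_le.2 ?_
    rintro _ ⟨r, k, u, v, hr, hu, hk, rfl⟩
    rw [circProd_eq_resMode]
    exact hg.map_mem_of_forall_homogeneous hT hgT
      (f ∘ₗ A.resMode (circExp T r k) (-1 - twistDelta r) u)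
      (fun s hs j w hw hj => h r hr s hs k j u w hu hk hw hj) v
  exact hle hx

theorem star_mem_OgSubmodule_left (hg : A.IsAutomorphism g) (hT : 0 < T) (hgT : g ^ T = 1)
    (a : V) {x : V} (hx : x ∈ OgSubmodule A T g) : A.star T g a x ∈ OgSubmodule A T g := by
  refine map_mem_of_mem_OgSubmodule hg hT hgT (A.star T g a) ?_ hx
  intro r hr s _ k j u w hu hk _ _
  refine hg.map_mem_of_forall_homogeneous hT hgT ((A.star T g).flip _) ?_ a
  intro t ht i a ha hi
  rw [LinearMap.flip_apply]
  rcases eq_or_ne t 0 with rfl | ht0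
  swap
  · rw [star_apply_of_ne_zero hT ht ht0 ha]
    exact Submodule.zero_mem _
  rw [star_apply_zero hT ha hi]
  obtain ⟨N, hN⟩ := (A.resMode_commutator i (circExp T r k) (-1) (-1 - twistDelta r) a u w).exists
  rw [sub_eq_iff_eq_add.1 hN]
  refine Submodule.add_mem _ (Submodule.sum_mem _ fun q _ => Submodule.sum_mem _ fun y hy =>
    Submodule.smul_mem _ _ ?_) ?_
  · have hmem := resMode_circExp_add_mem_OgSubmodule hg hr
      (hg.mode_mem_twistEigenspace_of_zero ha hu q) (A.mode_mem_weightSpace hi hk q) w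
      (le_refl (y.2 + 1))
    have hexp : circExp T r (i + k - q - 1) + (y.2 + 1 : ℕ) = i + circExp T r k - y.1 := by
      rw [show i + k - (q : ℤ) - 1 = k + (i - q - 1) by ring, circExp_add, ← mem_antidiagonal.1 hy]
      push_cast
      ring
    rwa [hexp, show -1 - twistDelta r - (y.2 + 1 : ℕ) = -1 + (-1 - twistDelta r) - y.2 by
      push_cast; ring] at hmem
  · simpa using resMode_circExp_mem_OgSubmodule hg hr (A.resMode i (-1) a w) 0 hu hk

theorem star_resMode_of_not_dvd (hg : A.IsAutomorphism g) (hT : 0 < T) {r s : ℕ} {u w : V}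
    (hu : u ∈ twistEigenspace T g r) (hw : w ∈ twistEigenspace T g s) (hrs : ¬T ∣ r + s) (α : ℂ)
    (l : ℤ) : A.star T g (A.resMode α l u w) = 0 := by
  obtain ⟨N, hN⟩ := (A.eventually_forall_mode_add_eq_zero l u w).exists
  rw [A.resMode_eq_sum hN, map_sum]
  refine sum_eq_zero fun i _ => ?_
  have hmem : A.Y u (l + i) w ∈ twistEigenspace T g ((r + s) % T) := by
    rw [twistEigenspace_mod hT]
    exact hg.mode_mem_twistEigenspace hu hw _
  rw [map_smul, star_apply_of_ne_zero hT (Nat.mod_lt _ hT) (mt Nat.dvd_of_mod_eq_zero hrs) hmem,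
    smul_zero]

theorem star_resMode_of_dvd (hg : A.IsAutomorphism g) (hT : 0 < T) {r s : ℕ} {k j : ℤ} {u w : V}
    (hu : u ∈ twistEigenspace T g r) (hk : u ∈ A.weightSpace k) (hw : w ∈ twistEigenspace T g s)
    (hj : w ∈ A.weightSpace j) (hrs : T ∣ r + s) {α β : ℂ} {l : ℤ}
    (hαβ : α + β = k + j - l - 1) (c : V) : ∀ᶠ N in atTop,
      A.star T g (A.resMode α l u w) c =
        ∑ i ∈ range N, ((-1 : ℂ) ^ i * Ring.choose (l : ℂ) i) •
          (A.resMode α (l - i) u (A.resMode β (-1 + i) w c) -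
            (-1 : ℂ) ^ l • A.resMode β (l - 1 - i) w (A.resMode α i u c)) := by
  filter_upwards [A.resMode_iterate α β l (-1) u w c,
    A.eventually_forall_mode_add_eq_zero l u w] with N hiter hN
  simp only [← sub_eq_add_neg] at hiter
  rw [← hiter, A.resMode_eq_sum hN, map_sum, LinearMap.sum_apply]
  refine sum_congr rfl fun i _ => ?_
  have hmem : A.Y u (l + i) w ∈ twistEigenspace T g 0 := by
    rw [← Nat.mod_eq_zero_of_dvd hrs, twistEigenspace_mod hT]
    exact hg.mode_mem_twistEigenspace hu hw _
  rw [map_smul, LinearMap.smul_apply, star_apply_zero hT hmem (A.mode_mem_weightSpace hk hj _),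
    hαβ]
  congr 4
  push_cast
  ring

theorem star_mem_OgSubmodule_right (hg : A.IsAutomorphism g) (hT : 0 < T) (hgT : g ^ T = 1)
    {x : V} (hx : x ∈ OgSubmodule A T g) (c : V) : A.star T g x c ∈ OgSubmodule A T g := by
  refine map_mem_of_mem_OgSubmodule hg hT hgT ((A.star T g).flip c) ?_ hx
  intro r hr s hs k j u w hu hk hw hj
  rw [LinearMap.flip_apply]
  by_cases hrs : T ∣ r + s
  · have hexp : circExp T r k + (circExp T s j + 1) = k + j - (-1 - twistDelta r : ℤ) - 1 := by
      rw [← add_assoc, circExp_add_circExp_of_dvd hr hs hrs]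
      push_cast
      ring
    obtain ⟨N, hN⟩ := (star_resMode_of_dvd hg hT hu hk hw hj hrs hexp c).exists
    rw [hN]
    refine Submodule.sum_mem _ fun i _ => Submodule.smul_mem _ _ (Submodule.sub_mem _
      (resMode_circExp_mem_OgSubmodule hg hr _ i hu hk) (Submodule.smul_mem _ _ ?_))
    have hmem := resMode_circExp_add_mem_OgSubmodule hg hs hw hj
      (A.resMode (circExp T r k) i u c) (Nat.le_add_left 1 i)
    rwa [Nat.cast_one, ← twistDelta_eq_of_dvd hr hs hrs, Nat.cast_succ, ← sub_sub,
      sub_right_comm] at hmem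
  · rw [star_resMode_of_not_dvd hg hT hu hw hrs, LinearMap.zero_apply]
    exact Submodule.zero_mem _

theorem star_star_sub_mem_OgSubmodule_of_homogeneous (hg : A.IsAutomorphism g) (hT : 0 < T)
    {k j : ℤ} {a b : V} (ha : a ∈ twistEigenspace T g 0) (hk : a ∈ A.weightSpace k)
    (hb : b ∈ twistEigenspace T g 0) (hj : b ∈ A.weightSpace j) (c : V) :
    A.star T g (A.star T g a b) c - A.star T g a (A.star T g b c) ∈ OgSubmodule A T g := by
  have hmem : ∀ {i : ℤ} {u : V}, u ∈ twistEigenspace T g 0 → u ∈ A.weightSpace i →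
      ∀ (m : ℕ) (v : V), A.resMode i (-1 - 1 - m) u v ∈ OgSubmodule A T g := fun hu hi m v => by
    simpa only [circExp_zero, twistDelta_zero] using resMode_circExp_mem_OgSubmodule hg hT v m hu hi
  have hexp : (k : ℂ) + j = k + j - (-1 : ℤ) - 1 := by push_cast; ring
  obtain ⟨N, hN⟩ := ((tendsto_add_atTop_nat 1).eventually
    (star_resMode_of_dvd hg hT ha hk hb hj (dvd_zero T) hexp c)).exists
  rw [star_apply_zero hT ha hk, hN, star_apply_zero hT hb hj, sum_range_succ', add_sub_assoc]
  refine Submodule.add_mem _ (Submodule.sum_mem _ fun i _ => Submodule.smul_mem _ _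
    (Submodule.sub_mem _ ?_ (Submodule.smul_mem _ _ ?_))) ?_
  · rw [Nat.cast_succ, add_comm, ← sub_sub]
    exact hmem ha hk i _
  · exact hmem hb hj (i + 1) _
  · rw [Ring.choose_zero_right, pow_zero, mul_one, one_smul, Nat.cast_zero, sub_zero (-1 : ℤ),
      add_zero, sub_sub_cancel_left]
    exact Submodule.neg_mem _ (Submodule.smul_mem _ _ (hmem hb hj 0 _))

end OgSubmodule

section ZhuAlgebra

theorem star_star_sub_mem_OgSubmodule (hg : A.IsAutomorphism g) (hT : 0 < T) (hgT : g ^ T = 1)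
    (a b c : V) :
    A.star T g (A.star T g a b) c - A.star T g a (A.star T g b c) ∈ OgSubmodule A T g := by
  refine hg.map_mem_of_forall_homogeneous hT hgT
    ((A.star T g).flip c ∘ₗ (A.star T g).flip b - (A.star T g).flip (A.star T g b c)) ?_ a
  intro r hr k a ha hk
  refine hg.map_mem_of_forall_homogeneous hT hgT
    ((A.star T g).flip c ∘ₗ A.star T g a - A.star T g a ∘ₗ (A.star T g).flip c) ?_ b
  intro s hs j b hb hj
  change A.star T g (A.star T g a b) c - A.star T g a (A.star T g b c) ∈ OgSubmodule A T g
  rcases eq_or_ne r 0 with rfl | hr0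
  · rcases eq_or_ne s 0 with rfl | hs0
    · exact star_star_sub_mem_OgSubmodule_of_homogeneous hg hT ha hk hb hj c
    · rw [star_apply_of_ne_zero hT hs hs0 hb, LinearMap.zero_apply, map_zero, sub_zero]
      exact star_mem_OgSubmodule_right hg hT hgT (star_mem_OgSubmodule_left hg hT hgT a
        (mem_OgSubmodule_of_ne_zero hs hs0 hb hj)) c
  · rw [star_apply_of_ne_zero hT hr hr0 ha, LinearMap.zero_apply, LinearMap.zero_apply, map_zero,
      LinearMap.zero_apply, sub_zero]
    exact Submodule.zero_mem _

theorem vac_star (hg : A.IsAutomorphism g) (hT : 0 < T) (a : V) : A.star T g A.vac a = a := by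
  rw [star_apply_zero hT hg.vac_mem_twistEigenspace A.vac_mem_weightSpace,
    A.resMode_eq_sum (N := 1) fun i hi => by
      rw [A.vacuum, if_neg (by omega), LinearMap.zero_apply],
    sum_range_one, Ring.choose_zero_right, one_smul, Nat.cast_zero, add_zero, A.vacuum,
    if_pos rfl, Module.End.one_apply]

theorem star_vac_sub_mem_OgSubmodule (hg : A.IsAutomorphism g) (hT : 0 < T) (hgT : g ^ T = 1)
    (a : V) : A.star T g a A.vac - a ∈ OgSubmodule A T g := by
  refine hg.map_mem_of_forall_homogeneous hT hgT ((A.star T g).flip A.vac - LinearMap.id) ?_ a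
  intro r hr k a ha hk
  rw [LinearMap.sub_apply, LinearMap.flip_apply, LinearMap.id_apply]
  rcases eq_or_ne r 0 with rfl | hr0
  · rw [star_apply_zero hT ha hk, A.resMode_eq_sum (N := 1) fun i hi =>
      A.creation_regular _ _ (by omega), sum_range_one, Ring.choose_zero_right, one_smul,
      Nat.cast_zero, add_zero, A.creation, sub_self]
    exact Submodule.zero_mem _
  · rw [star_apply_of_ne_zero hT hr hr0 ha, LinearMap.zero_apply, zero_sub]
    exact Submodule.neg_mem _ (mem_OgSubmodule_of_ne_zero hr hr0 ha hk)

/-- The bilinear map on `A_g(V)` induced by `*_g`. -/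
def starQuot (hg : A.IsAutomorphism g) (hT : 0 < T) (hgT : g ^ T = 1) :
    AgSpace A T g →ₗ[ℂ] AgSpace A T g →ₗ[ℂ] AgSpace A T g :=
  (OgSubmodule A T g).liftQ
    ((OgSubmodule A T g).mapQLinear (OgSubmodule A T g) ∘ₗ
      (A.star T g).codRestrict ((OgSubmodule A T g).compatibleMaps (OgSubmodule A T g))
        fun a _ hx => star_mem_OgSubmodule_left hg hT hgT a hx)
    fun _ hx => by
      rw [LinearMap.mem_ker]
      ext c
      exact (Submodule.Quotient.mk_eq_zero _).2 (star_mem_OgSubmodule_right hg hT hgT hx c)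

theorem starQuot_mk (hg : A.IsAutomorphism g) (hT : 0 < T) (hgT : g ^ T = 1) (u v : V) :
    starQuot hg hT hgT (Submodule.Quotient.mk u) (Submodule.Quotient.mk v) =
      Submodule.Quotient.mk (A.star T g u v) := rfl

/-- The associative algebra `A_g(V)`, with the product induced by `*_g`. -/
def zhuAlgebra (hg : A.IsAutomorphism g) (hT : 0 < T) (hgT : g ^ T = 1) : AgAlgebra A T g where
  mul := starQuot hg hT hgT
  mul_mk r k u v hr hu hk := by rw [starQuot_mk, star_eq_starProd hT hr hu hk]
  mul_assoc a b c := by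
    obtain ⟨a, rfl⟩ := Submodule.Quotient.mk_surjective _ a
    obtain ⟨b, rfl⟩ := Submodule.Quotient.mk_surjective _ b
    obtain ⟨c, rfl⟩ := Submodule.Quotient.mk_surjective _ c
    exact (Submodule.Quotient.eq _).2 (star_star_sub_mem_OgSubmodule hg hT hgT a b c)
  vac_mul a := by
    obtain ⟨a, rfl⟩ := Submodule.Quotient.mk_surjective _ a
    rw [starQuot_mk, vac_star hg hT]
  mul_vac a := by
    obtain ⟨a, rfl⟩ := Submodule.Quotient.mk_surjective _ a
    exact (Submodule.Quotient.eq _).2 (star_vac_sub_mem_OgSubmodule hg hT hgT a)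

end ZhuAlgebra

end VertexOperatorAlgebra

/-! ### Twisted modules -/

namespace WeakTwistedModule

variable {V : Type*} [AddCommGroup V] [Module ℂ V] {A : VertexOperatorAlgebra V} {T : ℕ}
  {g : V ≃ₗ[ℂ] V} {M : Type*} [AddCommGroup M] [Module ℂ M] (W : WeakTwistedModule A T g M)

section Modes

/-- The mode `u ↦ u_q` of a fixed index `q`, as a linear map. -/
def mode (q : ℚ) : V →ₗ[ℂ] Module.End ℂ M :=
  LinearMap.proj (R := ℂ) (φ := fun _ : ℚ => Module.End ℂ M) q ∘ₗ W.Y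

theorem mode_apply (q : ℚ) (v : V) : W.mode q v = W.Y v q := rfl

theorem commutator {r : ℕ} (hr : r < T) {u : V} (hu : u ∈ twistEigenspace T g r) {m : ℚ}
    (hm : ∃ j : ℤ, m = (r : ℚ) / T + j) (v : V) (n : ℚ) (w : M) :
    W.Y u m (W.Y v n w) - W.Y v n (W.Y u m w) =
      ∑ᶠ i : ℕ, ((Ring.choose m i : ℚ) : ℂ) • W.Y (A.Y u i v) (m + n - i) w := by
  have h := W.jacobi r hr u hu v w 0 m n hm
  rw [finsum_eq_single _ 0 fun i hi => by
    rw [Ring.choose_zero_pos ℤ (Nat.pos_of_ne_zero hi), Int.cast_zero, mul_zero, zero_smul]] at h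
  simpa only [Ring.choose_zero_right, pow_zero, zpow_zero, Int.cast_one, Int.cast_zero, mul_one,
    one_smul, zero_add, Nat.cast_zero, add_zero, sub_zero] using h

theorem associativity {r : ℕ} (hr : r < T) {u : V} (hu : u ∈ twistEigenspace T g r) {m : ℚ}
    (hm : ∃ j : ℤ, m = (r : ℚ) / T + j) {w : M} (hw : ∀ i : ℕ, W.Y u (m + i) w = 0) (v : V)
    (l : ℤ) (n : ℚ) :
    ∑ᶠ i : ℕ, ((-1 : ℂ) ^ i * ((Ring.choose l i : ℤ) : ℂ)) •
        W.Y u (l + m - i) (W.Y v (n + i) w) =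
      ∑ᶠ i : ℕ, ((Ring.choose m i : ℚ) : ℂ) • W.Y (A.Y u (l + i) v) (m + n - i) w := by
  have h := W.jacobi r hr u hu v w l m n hm
  simpa only [hw, map_zero, smul_zero, sub_zero] using h

theorem eventually_forall_mode_add_eq_zero (n : ℚ) (v : V) (w : M) :
    ∀ᶠ N : ℕ in atTop, ∀ i : ℕ, N ≤ i → W.Y v (n + i) w = 0 := by
  obtain ⟨K, hK⟩ := W.truncation v w
  obtain ⟨N₀, hN₀⟩ := exists_nat_ge (K - n)
  filter_upwards [eventually_ge_atTop N₀] with N hN i hi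
  have : (N₀ : ℚ) ≤ i := by exact_mod_cast hN.trans hi
  exact hK _ (by linarith)

end Modes

section ZeroMode

/-- The linear map `o` with `o(v) = v_{wt v - 1}` for homogeneous `v`. -/
def zeroMode : V →ₗ[ℂ] Module.End ℂ M := A.weightwise fun k => W.mode (k - 1)

theorem zeroMode_apply {k : ℤ} {u : V} (hu : u ∈ A.weightSpace k) :
    W.zeroMode u = W.Y u ((k : ℚ) - 1) := by
  rw [zeroMode, A.weightwise_apply _ hu, mode_apply]

theorem zeroMode_vac : W.zeroMode A.vac = 1 := by
  rw [W.zeroMode_apply A.vac_mem_weightSpace, W.vacuum, Int.cast_zero, zero_sub, if_pos rfl]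

theorem zeroMode_of_ne_zero {r : ℕ} (hr : r < T) (h0 : r ≠ 0) {k : ℤ} {u : V}
    (hu : u ∈ twistEigenspace T g r) (hk : u ∈ A.weightSpace k) : W.zeroMode u = 0 := by
  rw [W.zeroMode_apply hk]
  refine W.mode_support r hr u hu _ ?_
  rintro ⟨j, hj⟩
  have hT : (T : ℚ) ≠ 0 := Nat.cast_ne_zero.2 (by omega)
  have hdvd : (r : ℤ) = T * (k - 1 - j) := by
    have : (r : ℚ) = T * (k - 1 - j) := by
      rw [hj, add_sub_cancel_right, mul_div_cancel₀ _ hT]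
    exact_mod_cast this
  exact h0 (Nat.eq_zero_of_dvd_of_lt (Int.natCast_dvd_natCast.1 (Dvd.intro _ hdvd.symm)) hr)

theorem zeroMode_resMode {k j : ℤ} {u v : V} (hk : u ∈ A.weightSpace k)
    (hj : v ∈ A.weightSpace j) {r : ℕ} (hr : r < T) (hu : u ∈ twistEigenspace T g r) {m : ℚ}
    (hm : ∃ i : ℤ, m = (r : ℚ) / T + i) {l : ℤ} {n : ℚ} (hn : m + n = k + j - l - 2) (w : M) :
    W.zeroMode (A.resMode m l u v) w =
      ∑ᶠ i : ℕ, ((-1 : ℂ) ^ i * ((Ring.choose l i : ℤ) : ℂ)) •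
        (W.Y u (l + m - i) (W.Y v (n + i) w) -
          (-1 : ℂ) ^ l • W.Y v (l + n - i) (W.Y u (m + i) w)) := by
  obtain ⟨N, hN⟩ := (A.eventually_forall_mode_add_eq_zero l u v).exists
  rw [W.jacobi r hr u hu v w l m n hm, finsum_eq_sum_range (N := N) fun i hi => by
      rw [hN i hi, map_zero, Pi.zero_apply, LinearMap.zero_apply, smul_zero],
    A.resMode_eq_sum hN, map_sum, LinearMap.sum_apply]
  refine sum_congr rfl fun i _ => ?_
  rw [map_smul, LinearMap.smul_apply, W.zeroMode_apply (A.mode_mem_weightSpace hk hj _), hn,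
    ratCast_choose]
  rw [show ((k + j - (l + i) - 1 : ℤ) : ℚ) - 1 = k + j - l - 2 - i by push_cast; ring]

theorem zeroMode_circ_apply {w : M} (hw : w ∈ W.Omega) {k j : ℤ} {u v : V}
    (hk : u ∈ A.weightSpace k) (hj : v ∈ A.weightSpace j) {r : ℕ} (hr : r < T)
    (hu : u ∈ twistEigenspace T g r) :
    W.zeroMode (A.resMode (circExp T r k) (-1 - twistDelta r) u v) w = 0 := by
  have hdiv : (r : ℚ) / T < 1 := by
    rw [div_lt_one (by exact_mod_cast r.zero_le.trans_lt hr)]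
    exact_mod_cast hr
  have hpos : 0 < (twistDelta r : ℚ) + (r : ℚ) / T := by
    rcases Nat.eq_zero_or_pos r with rfl | h0
    · simp [twistDelta_zero]
    · have : (0 : ℚ) ≤ twistDelta r := by exact_mod_cast twistDelta_nonneg r
      have : (0 : ℚ) < r / T := div_pos (by exact_mod_cast h0) (by exact_mod_cast h0.trans hr)
      linarith
  have hexp : circExp T r k = ((r / T + (k - 1 + twistDelta r : ℤ) : ℚ) : ℂ) := by
    simp only [circExp]; push_cast; ring
  rw [hexp, W.zeroMode_resMode hk hj hr hu ⟨_, rfl⟩ (n := j - r / T) (by push_cast; ring)]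
  refine finsum_eq_zero_of_forall_eq_zero fun i => ?_
  have : (0 : ℚ) ≤ i := Nat.cast_nonneg i
  rw [hw j v hj _ (by linarith), hw k u hk _ (by push_cast; linarith), map_zero, map_zero,
    smul_zero, sub_zero, smul_zero]

theorem zeroMode_star_apply (hT : 0 < T) {w : M} (hw : w ∈ W.Omega) {k j : ℤ} {u v : V}
    (hk : u ∈ A.weightSpace k) (hj : v ∈ A.weightSpace j) (hu : u ∈ twistEigenspace T g 0) :
    W.zeroMode (A.star T g u v) w = W.zeroMode u (W.zeroMode v w) := by
  have h := W.zeroMode_resMode hk hj hT hu (m := k) ⟨k, by simp⟩ (l := -1) (n := j - 1)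
    (by push_cast; ring) w
  rw [finsum_eq_single _ 0 fun i hi => by
      have : (1 : ℚ) ≤ i := by exact_mod_cast Nat.pos_of_ne_zero hi
      rw [hw j v hj _ (by linarith), hw k u hk _ (by linarith), map_zero, map_zero, smul_zero,
        sub_zero, smul_zero],
    Nat.cast_zero, hw k u hk _ (by linarith)] at h
  rw [A.star_apply_zero hT hu hk, W.zeroMode_apply hk, W.zeroMode_apply hj]
  simpa [sub_eq_neg_add] using h

theorem zeroMode_apply_of_mem_OgSubmodule (hg : A.IsAutomorphism g) (hT : 0 < T)
    (hgT : g ^ T = 1) {x : V} (hx : x ∈ OgSubmodule A T g) {w : M} (hw : w ∈ W.Omega) :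
    W.zeroMode x w = 0 :=
  VertexOperatorAlgebra.map_mem_of_mem_OgSubmodule hg hT hgT (W.zeroMode.flip w) (N := ⊥)
    (fun _ hr _ _ _ _ _ _ hu hk _ hj => W.zeroMode_circ_apply hw hk hj hr hu) hx

theorem zeroMode_star (hg : A.IsAutomorphism g) (hT : 0 < T) (hgT : g ^ T = 1) (u v : V)
    {w : M} (hw : w ∈ W.Omega) :
    W.zeroMode (A.star T g u v) w = W.zeroMode u (W.zeroMode v w) := by
  refine sub_eq_zero.1 (hg.map_mem_of_forall_homogeneous hT hgT (N := ⊥)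
    (W.zeroMode.flip w ∘ₗ (A.star T g).flip v - W.zeroMode.flip (W.zeroMode v w)) ?_ u)
  intro r hr k u hu hk
  refine A.map_mem_of_forall_weightSpace (N := ⊥)
    (W.zeroMode.flip w ∘ₗ A.star T g u - W.zeroMode u ∘ₗ W.zeroMode.flip w) ?_ v
  intro j v hj
  refine sub_eq_zero.2 ?_
  change W.zeroMode (A.star T g u v) w = W.zeroMode u (W.zeroMode v w)
  rcases eq_or_ne r 0 with rfl | hr0
  · exact W.zeroMode_star_apply hT hw hk hj hu
  · rw [A.star_apply_of_ne_zero hT hr hr0 hu, W.zeroMode_of_ne_zero hr hr0 hu hk,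
      LinearMap.zero_apply, LinearMap.zero_apply, map_zero, LinearMap.zero_apply]

end ZeroMode

section Omega

variable {W} in
theorem mem_Omega_of_forall_twistEigenspace (hg : A.IsAutomorphism g) (hT : 0 < T)
    (hgT : g ^ T = 1) {w : M} (h : ∀ r < T, ∀ k, ∀ a ∈ twistEigenspace T g r,
      a ∈ A.weightSpace k → ∀ m : ℚ, (k : ℚ) - m - 1 < 0 → W.Y a m w = 0) : w ∈ W.Omega := by
  intro k a ha m hm
  rw [← W.mode_apply, ← sum_twistProj_apply (g := g) hT a, map_sum, LinearMap.sum_apply]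
  exact sum_eq_zero fun r hr => h r (mem_range.1 hr) k _ (twistProj_mem hT hgT r a)
    (hg.twistProj_mem_weightSpace r ha) m hm

theorem zeroMode_mem_Omega (hg : A.IsAutomorphism g) (hT : 0 < T) (hgT : g ^ T = 1) (v : V)
    {w : M} (hw : w ∈ W.Omega) : W.zeroMode v w ∈ W.Omega := by
  refine A.map_mem_of_forall_weightSpace (W.zeroMode.flip w) (fun j v hj => ?_) v
  refine mem_Omega_of_forall_twistEigenspace hg hT hgT fun r hr k a ha hk m hm => ?_
  rw [LinearMap.flip_apply, W.zeroMode_apply hj]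
  by_cases hmr : ∃ i : ℤ, m = (r : ℚ) / T + i
  · have h := W.commutator hr ha hmr v (j - 1) w
    rw [hw k a hk m hm, map_zero, sub_zero] at h
    rw [h]
    refine finsum_eq_zero_of_forall_eq_zero fun i => ?_
    rw [hw _ _ (A.mode_mem_weightSpace hk hj i) _ (by push_cast; linarith), smul_zero]
  · rw [W.mode_support r hr a ha m hmr, LinearMap.zero_apply]

/-- The action of `V` on `Ω(M)` by zero modes. -/
def omegaAction (hg : A.IsAutomorphism g) (hT : 0 < T) (hgT : g ^ T = 1) :
    V →ₗ[ℂ] Module.End ℂ W.Omega where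
  toFun v := (W.zeroMode v).restrict fun _ hw => W.zeroMode_mem_Omega hg hT hgT v hw
  map_add' u v := by ext w; simp
  map_smul' c v := by ext w; simp

/-- The representation of `A_g(V)` on `Ω(M)` by zero modes. -/
def omegaRep (hg : A.IsAutomorphism g) (hT : 0 < T) (hgT : g ^ T = 1) :
    (VertexOperatorAlgebra.zhuAlgebra hg hT hgT).Carrier →ₐ[ℂ] Module.End ℂ W.Omega :=
  AlgHom.ofLinearMap
    ((OgSubmodule A T g).liftQ (W.omegaAction hg hT hgT) fun x hx => by
      ext w
      exact W.zeroMode_apply_of_mem_OgSubmodule hg hT hgT hx w.2)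
    (by
      ext w
      exact LinearMap.congr_fun W.zeroMode_vac (w : M))
    (by
      intro a b
      obtain ⟨a, rfl⟩ := Submodule.Quotient.mk_surjective _ a
      obtain ⟨b, rfl⟩ := Submodule.Quotient.mk_surjective _ b
      ext w
      exact W.zeroMode_star hg hT hgT a b w.2)

theorem coe_omegaRep_toClass (hg : A.IsAutomorphism g) (hT : 0 < T) (hgT : g ^ T = 1) (v : V)
    (w : W.Omega) :
    (W.omegaRep hg hT hgT ((VertexOperatorAlgebra.zhuAlgebra hg hT hgT).toClass v) w : M) =
      W.zeroMode v w := rfl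

end Omega

section CyclicSpan

/-- The span of all `v_t w`; by associativity it is the submodule generated by `w`. -/
def cyclicSpan (w : M) : Submodule ℂ M := Submodule.span ℂ {y | ∃ (v : V) (t : ℚ), y = W.Y v t w}

theorem mode_mem_cyclicSpan (v : V) (t : ℚ) (w : M) : W.Y v t w ∈ W.cyclicSpan w :=
  Submodule.subset_span ⟨v, t, rfl⟩

theorem self_mem_cyclicSpan (w : M) : w ∈ W.cyclicSpan w := by
  have := W.mode_mem_cyclicSpan A.vac (-1) w
  rwa [W.vacuum, if_pos rfl] at this

theorem mode_mode_mem_cyclicSpan_of_forall_succ {r : ℕ} (hr : r < T) {u : V}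
    (hu : u ∈ twistEigenspace T g r) {m : ℚ} (hm : ∃ j : ℤ, m = (r : ℚ) / T + j) {w : M}
    (hw : ∀ i : ℕ, W.Y u (m + i) w = 0) {v : V} {l : ℤ} {n : ℚ}
    (h : ∀ i : ℕ, W.Y u (l + m - (i + 1 : ℕ)) (W.Y v (n + (i + 1 : ℕ)) w) ∈ W.cyclicSpan w) :
    W.Y u (l + m) (W.Y v n w) ∈ W.cyclicSpan w := by
  have hassoc := W.associativity hr hu hm hw v l n
  obtain ⟨N, hN⟩ := (W.eventually_forall_mode_add_eq_zero n v w).exists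
  rw [finsum_eq_sum_range (N := N + 1) fun i hi => by
      rw [hN i (by omega), map_zero, smul_zero],
    sum_range_succ', ← eq_sub_iff_add_eq', Ring.choose_zero_right, Int.cast_one, pow_zero,
    mul_one, one_smul, Nat.cast_zero, sub_zero, add_zero] at hassoc
  rw [hassoc]
  refine Submodule.sub_mem _ ?_ (Submodule.sum_mem _ fun i _ => Submodule.smul_mem _ _ (h i))
  exact finsum_induction (· ∈ W.cyclicSpan w) (Submodule.zero_mem _)
    (fun _ _ => Submodule.add_mem _)
    fun i => Submodule.smul_mem _ _ (W.mode_mem_cyclicSpan _ _ _)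

theorem mode_mode_mem_cyclicSpan {r : ℕ} (hr : r < T) {u : V} (hu : u ∈ twistEigenspace T g r)
    (v : V) (w : M) (q t : ℚ) : W.Y u q (W.Y v t w) ∈ W.cyclicSpan w := by
  by_cases hq : ∃ j : ℤ, q = (r : ℚ) / T + j
  swap
  · rw [W.mode_support r hr u hu q hq]
    exact Submodule.zero_mem _
  obtain ⟨K, hK⟩ := W.truncation v w
  obtain ⟨N, hN⟩ := (W.eventually_forall_mode_add_eq_zero (r / T) u w).exists
  have hw : ∀ i : ℕ, W.Y u ((r : ℚ) / T + (N : ℤ) + i) w = 0 := fun i => by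
    have := hN (N + i) (Nat.le_add_right N i)
    rwa [Nat.cast_add, ← add_assoc] at this
  obtain ⟨d, hd⟩ := exists_nat_gt (K - t)
  obtain ⟨j, rfl⟩ := hq
  -- Associativity raises the index of `v`, which truncation bounds.
  induction d generalizing t j with
  | zero =>
    rw [hK t (by rw [Nat.cast_zero] at hd; linarith), map_zero]
    exact Submodule.zero_mem _
  | succ d ih =>
    have hindex : (r : ℚ) / T + j = (j - N : ℤ) + ((r : ℚ) / T + (N : ℤ)) := by push_cast; ring
    rw [hindex]
    refine W.mode_mode_mem_cyclicSpan_of_forall_succ hr hu ⟨N, rfl⟩ hw fun i => ?_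
    have : (0 : ℚ) ≤ i := Nat.cast_nonneg i
    have hmem := ih (t + (i + 1 : ℕ)) (by push_cast at hd ⊢; linarith) (j - (i + 1 : ℕ))
    rwa [Int.cast_sub, Int.cast_natCast, ← add_sub_assoc, hindex] at hmem

theorem mode_mem_cyclicSpan_of_mem (hg : A.IsAutomorphism g) (hT : 0 < T) (hgT : g ^ T = 1)
    (u : V) (q : ℚ) {w y : M} (hy : y ∈ W.cyclicSpan w) : W.Y u q y ∈ W.cyclicSpan w := by
  refine hg.map_mem_of_forall_homogeneous hT hgT ((W.mode q).flip y) (fun r hr k u hu _ => ?_) u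
  have hle : W.cyclicSpan w ≤ (W.cyclicSpan w).comap (W.Y u q) := by
    refine Submodule.span_le.2 ?_
    rintro _ ⟨v, t, rfl⟩
    exact W.mode_mode_mem_cyclicSpan hr hu v w q t
  exact hle hy

theorem map_mem_of_mem_cyclicSpan {X : Type*} [AddCommGroup X] [Module ℂ X] (f : M →ₗ[ℂ] X)
    {N : Submodule ℂ X} {w : M} (h : ∀ k, ∀ v ∈ A.weightSpace k, ∀ t, f (W.Y v t w) ∈ N) {y : M}
    (hy : y ∈ W.cyclicSpan w) : f y ∈ N := by
  have hle : W.cyclicSpan w ≤ N.comap f := by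
    refine Submodule.span_le.2 ?_
    rintro _ ⟨v, t, rfl⟩
    exact A.map_mem_of_forall_weightSpace (f ∘ₗ (W.mode t).flip w) (fun k v hv => h k v hv t) v
  exact hle hy

end CyclicSpan

end WeakTwistedModule

/-! ### Admissible modules -/

namespace AdmissibleTwistedModule

variable {V : Type*} [AddCommGroup V] [Module ℂ V] {A : VertexOperatorAlgebra V} {T : ℕ}
  {g : V ≃ₗ[ℂ] V} {M : Type*} [AddCommGroup M] [Module ℂ M] (W : AdmissibleTwistedModule A T g M)

section Grading

theorem gr_eq_bot_of_neg {q : ℚ} (hq : q < 0) : W.gr q = ⊥ := by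
  refine W.gr_support q ?_
  rintro ⟨j, rfl⟩
  exact hq.not_ge (by positivity)

instance : DirectSum.Decomposition W.gr := W.gr_internal.chooseDecomposition

/-- The projection of `M` onto `M(q)` along the other homogeneous spaces. -/
def component (q : ℚ) : M →ₗ[ℂ] M :=
  (W.gr q).subtype ∘ₗ DirectSum.component ℂ ℚ (fun q => W.gr q) q ∘ₗ
    (DirectSum.decomposeLinearEquiv W.gr : M →ₗ[ℂ] _)

theorem component_mem (q : ℚ) (x : M) : W.component q x ∈ W.gr q := Subtype.property _

theorem component_of_mem {q : ℚ} {x : M} (hx : x ∈ W.gr q) : W.component q x = x :=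
  DirectSum.decompose_of_mem_same W.gr hx

theorem component_of_mem_of_ne {p q : ℚ} {x : M} (hx : x ∈ W.gr p) (hpq : p ≠ q) :
    W.component q x = 0 :=
  DirectSum.decompose_of_mem_ne W.gr hx hpq

theorem mem_of_component_mem {N : Submodule ℂ M} {x : M} (h : ∀ q, W.component q x ∈ N) :
    x ∈ N := by
  classical
  rw [← DirectSum.sum_support_decompose W.gr x]
  exact Submodule.sum_mem _ fun q _ => h q

theorem component_mode {k : ℤ} {v : V} (hv : v ∈ A.weightSpace k) (m q : ℚ) (x : M) :
    W.component (q + k - m - 1) (W.Y v m x) = W.Y v m (W.component q x) := by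
  induction x using DirectSum.Decomposition.inductionOn W.gr with
  | zero => simp only [map_zero]
  | add x y hx hy => simp only [map_add, hx, hy]
  | @homogeneous p x =>
    have hmode := W.mode_gr k v hv m p x x.2
    rcases eq_or_ne p q with rfl | hpq
    · rw [W.component_of_mem x.2, W.component_of_mem hmode]
    · rw [W.component_of_mem_of_ne x.2 hpq, map_zero,
        W.component_of_mem_of_ne hmode fun h => hpq (by linarith)]

end Grading

section LowestWeight

theorem component_mem_Omega {w : M} (hw : w ∈ W.Omega) (q : ℚ) : W.component q w ∈ W.Omega := by
  intro k a ha m hm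
  rw [← W.component_mode ha, hw k a ha m hm, map_zero]

theorem gr_zero_le_Omega : W.gr 0 ≤ W.Omega := by
  intro w hw k a ha m hm
  have := W.mode_gr k a ha m 0 w hw
  rwa [W.gr_eq_bot_of_neg (by linarith), Submodule.mem_bot] at this

theorem isGradedSubmodule_cyclicSpan (hg : A.IsAutomorphism g) (hT : 0 < T) (hgT : g ^ T = 1)
    {n : ℚ} {w : M} (hw : w ∈ W.gr n) : W.IsGradedSubmodule (W.cyclicSpan w) where
  mode_mem u q _ hy := W.mode_mem_cyclicSpan_of_mem hg hT hgT u q hy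
  graded := by
    refine le_antisymm (fun y hy => ?_) (iSup_le fun q => inf_le_left)
    refine W.map_mem_of_mem_cyclicSpan LinearMap.id (fun k v hv t => ?_) hy
    exact Submodule.mem_iSup_of_mem (n + k - t - 1)
      ⟨W.mode_mem_cyclicSpan v t w, W.mode_gr k v hv t n w hw⟩

variable {W}

theorem component_eq_zero_of_mem_cyclicSpan {q p : ℚ} {w y : M} (hw : w ∈ W.gr q)
    (hΩ : w ∈ W.Omega) (hpq : p < q) (hy : y ∈ W.cyclicSpan w) : W.component p y = 0 := by
  refine W.map_mem_of_mem_cyclicSpan (N := ⊥) (W.component p) (fun k v hv t => ?_) hy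
  rw [Submodule.mem_bot]
  rcases lt_or_ge ((k : ℚ) - t - 1) 0 with hneg | hneg
  · rw [hΩ k v hv t hneg, map_zero]
  · exact W.component_of_mem_of_ne (W.mode_gr k v hv t q w hw) (by linarith)

theorem component_zero_mem_range_zeroMode {w y : M} (hw : w ∈ W.gr 0) (hy : y ∈ W.cyclicSpan w) :
    W.component 0 y ∈ LinearMap.range (W.zeroMode.flip w) := by
  refine W.map_mem_of_mem_cyclicSpan (W.component 0) (fun k v hv t => ?_) hy
  have hmode := W.mode_gr k v hv t 0 w hw
  rcases eq_or_ne (0 + (k : ℚ) - t - 1) 0 with ht | ht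
  · refine ⟨v, ?_⟩
    rw [LinearMap.flip_apply, W.zeroMode_apply hv, show (k : ℚ) - 1 = t by linarith,
      W.component_of_mem (ht ▸ hmode)]
  · rw [W.component_of_mem_of_ne hmode ht]
    exact Submodule.zero_mem _

theorem IsSimple.mem_cyclicSpan (hW : W.IsSimple) (hg : A.IsAutomorphism g) (hT : 0 < T)
    (hgT : g ^ T = 1) {n : ℚ} {w : M} (hw : w ∈ W.gr n) (h0 : w ≠ 0) (y : M) :
    y ∈ W.cyclicSpan w := by
  rcases hW.2 _ (W.isGradedSubmodule_cyclicSpan hg hT hgT hw) with h | h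
  · have := W.self_mem_cyclicSpan w
    rw [h, Submodule.mem_bot] at this
    exact absurd this h0
  · exact h ▸ Submodule.mem_top

theorem IsSimple.Omega_eq_gr_zero (hW : W.IsSimple) (hg : A.IsAutomorphism g) (hT : 0 < T)
    (hgT : g ^ T = 1) (hM0 : W.gr 0 ≠ ⊥) : W.Omega = W.gr 0 := by
  refine le_antisymm (fun w hw => W.mem_of_component_mem fun q => ?_) W.gr_zero_le_Omega
  have hx := W.component_mem q w
  rcases lt_trichotomy q 0 with hq | rfl | hq
  · rw [W.gr_eq_bot_of_neg hq, Submodule.mem_bot] at hx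
    exact hx ▸ Submodule.zero_mem _
  · exact hx
  · suffices h : W.component q w = 0 from h ▸ Submodule.zero_mem _
    by_contra h0
    obtain ⟨y, hy, hy0⟩ := Submodule.exists_mem_ne_zero_of_ne_bot hM0
    have hcyclic := hW.mem_cyclicSpan hg hT hgT hx h0 y
    rw [← W.component_of_mem hy] at hy0
    exact hy0 (component_eq_zero_of_mem_cyclicSpan hx (W.component_mem_Omega hw q) hq hcyclic)

theorem IsSimple.exists_zeroMode_apply_eq (hW : W.IsSimple) (hg : A.IsAutomorphism g) (hT : 0 < T)
    (hgT : g ^ T = 1) {w y : M} (hw : w ∈ W.gr 0) (h0 : w ≠ 0) (hy : y ∈ W.gr 0) :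
    ∃ v, W.zeroMode v w = y := by
  have h := component_zero_mem_range_zeroMode hw (hW.mem_cyclicSpan hg hT hgT hw h0 y)
  rwa [W.component_of_mem hy] at h

end LowestWeight

end AdmissibleTwistedModule

end

theorem proposition5_general {V : Type*} [AddCommGroup V] [Module ℂ V]
    {A : VertexOperatorAlgebra V} {g : V ≃ₗ[ℂ] V} (hg : A.IsAutomorphism g) {T : ℕ} (hT : 0 < T)
    (hgT : g ^ T = 1) {M : Type*} [AddCommGroup M] [Module ℂ M]
    (W : AdmissibleTwistedModule A T g M) (hsimple : W.IsSimple) (hM0 : W.gr 0 ≠ ⊥) :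
    W.Omega = W.gr 0 ∧
    ∃ (S : AgAlgebra A T g) (_ : Module S.Carrier W.Omega),
      IsScalarTower ℂ S.Carrier W.Omega ∧
      (∀ (k : ℤ) (a : V), a ∈ twistEigenspace T g 0 → a ∈ A.weightSpace k → ∀ w : W.Omega,
        ((S.toClass a • w : W.Omega) : M) = W.Y a ((k : ℚ) - 1) (w : M)) ∧
      IsSimpleModule S.Carrier W.Omega := by
  have hΩ := hsimple.Omega_eq_gr_zero hg hT hgT hM0
  let S := VertexOperatorAlgebra.zhuAlgebra hg hT hgT
  let ρ : S.Carrier →ₐ[ℂ] Module.End ℂ W.Omega := W.omegaRep hg hT hgT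
  let _ : Module S.Carrier W.Omega := Module.compHom W.Omega ρ.toRingHom
  have hρ : ∀ (v : V) (w : W.Omega), ((S.toClass v • w : W.Omega) : M) = W.zeroMode v w :=
    W.coe_omegaRep_toClass hg hT hgT
  refine ⟨hΩ, S, inferInstance, ⟨fun c s w => ?_⟩, fun k a _ hk w => ?_, ?_⟩
  · exact LinearMap.congr_fun (map_smul ρ c s) w
  · rw [hρ, W.zeroMode_apply hk]
  · refine isSimpleModule_iff_toSpanSingleton_surjective.2 ⟨?_, fun w hw y => ?_⟩
    · exact (Submodule.nontrivial_iff_ne_bot).2 (hΩ ▸ hM0)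
    · obtain ⟨v, hv⟩ := hsimple.exists_zeroMode_apply_eq hg hT hgT (hΩ.le w.2)
        (fun h => hw (Subtype.ext h)) (hΩ.le y.2)
      exact ⟨S.toClass v, Subtype.ext hv⟩

theorem proposition5 {V : Type*} [AddCommGroup V] [Module ℂ V] (A : VertexOperatorAlgebra V)
    (g : V ≃ₗ[ℂ] V) (hg : A.IsAutomorphism g) (T : ℕ) (hT : 0 < T) (hord : orderOf g = T)
    {M : Type*} [AddCommGroup M] [Module ℂ M] (W : AdmissibleTwistedModule A T g M)
    (hsimple : W.IsSimple) (hM0 : W.gr 0 ≠ ⊥) :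
    W.Omega = W.gr 0 ∧
    ∃ (S : AgAlgebra A T g) (_ : Module S.Carrier W.Omega),
      IsScalarTower ℂ S.Carrier W.Omega ∧
      (∀ (k : ℤ) (a : V), a ∈ twistEigenspace T g 0 → a ∈ A.weightSpace k → ∀ w : W.Omega,
        ((S.toClass a • w : W.Omega) : M) = W.Y a ((k : ℚ) - 1) (w : M)) ∧
      IsSimpleModule S.Carrier W.Omega :=
  proposition5_general hg hT (hord ▸ pow_orderOf_eq_one g) W hsimple hM0
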